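/- Consider first-order rational Pavelka logic $\mathbf{RPL}\forall$, with truth values in $[0,1]$ ($0$ is the truest value, $1$ the falsest), primitive connectives $\to$ (interpreted by $(x,y)\mapsto\max(y-x,0)$), $\forall$ (interpreted by the supremum), a truth constant $\bar r$ for each $r\in\mathbb{Q}\cap[0,1]$, $\bot=\bar 1$, $\neg\varphi=\varphi\to\bot$, $\varphi\vee\psi=(\varphi\to\psi)\to\psi$, and with its usual Hilbert-style provability relation $\vdash$ (the axioms and rules of first-order Łukasiewicz logic together with the bookkeeping axioms $(\bar r\to\bar s)\leftrightarrow\overline{\max(s-r,0)}$). A theory $T$ is a set of formulas in a language; it is *computably axiomatizable* if its language is computably given and its set of axioms is computably enumerable, *consistent* if $T\nvdash\bot$, and *linear-complete* if for all sentences $\varphi,\psi$ of its language $T\vdash\varphi\to\psi$ or $T\vdash\psi\to\varphi$. A theory $T'$ *extends* $T$ if the language of $T'$ contains that of $T$ and $T'$ proves every axiom of $T$. A *decidable model* of $T$ is a standard ($[0,1]$-valued) structure on a complete metric space (a countable structure being given the discrete metric), with continuous operations and relations, in which for some evaluation all axioms of $T$ have truth degree $0$, and which has a countable dense set of elements, enumerated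 as $(e_n)_{n\in\mathbb N}$, such that the set of all pairs of a formula with parameters among the $e_n$ (named by their indices) and a rational interval $[p,q]\subseteq[0,1]$ whose interior relative to $[0,1]$ contains the truth degree of that formula is computably enumerable. **Corollary 3.11.** There is a computably axiomatizable, consistent theory $T$ in $\mathbf{RPL}\forall$ that has no decidable model and that moreover has no computably axiomatizable, consistent, linear-complete extension. The theory $T$ can be taken to be a classical theory of Łukasiewicz logic: its axioms contain no truth constant other than $\bot$, and $T\vdash\varphi\vee\neg\varphi$ for every formula $\varphi$ of its language that contains no truth constant other than $\bot$. -/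

import Mathlib

universe u

namespace RPL

/-! ### Syntax

Symbols are pairs (arity, index). A language is a set of function symbols together with a set of
relation symbols; constants are function symbols of arity 0, and the variables are indexed by the
natural numbers. There is no logical equality: a similarity relation, if wanted, is a binary relation
symbol of the language. -/

/-- A first-order language: which pairs (arity, index) are its function and relation symbols. -/
structure Lang where
  funs : Set (ℕ × ℕ)
  rels : Set (ℕ × ℕ)

/-- `L` is computably given: its sets of function and of relation symbols are decidable
(the arity of a symbol is its first coordinate). -/
def Lang.ComputablyGiven (L : Lang) : Prop :=
  ComputablePred (fun p : ℕ × ℕ => p ∈ L.funs) ∧ ComputablePred (fun p : ℕ × ℕ => p ∈ L.rels)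

/-- The rationals in `[0, 1]`. -/
abbrev UnitRat : Type := {r : ℚ // 0 ≤ r ∧ r ≤ 1}

/-- Truncated subtraction `s ∸ r = max (s - r) 0` on the rationals in `[0, 1]`. -/
def UnitRat.tsub (s r : UnitRat) : UnitRat :=
  ⟨max (s.1 - r.1) 0, le_max_right _ _,
    max_le (by linarith [s.2.2, r.2.1]) zero_le_one⟩

inductive Term : Type
  | var (x : ℕ) : Term
  | app (k i : ℕ) (ts : Fin k → Term) : Term

/-- Formulas of rational Pavelka logic. The truth constants are the rationals in `[0, 1]`,
where 0 is the truest and 1 the falsest value. -/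
inductive Formula : Type
  | const (r : UnitRat) : Formula
  | rel (k i : ℕ) (ts : Fin k → Term) : Formula
  | imp (φ ψ : Formula) : Formula
  | all (x : ℕ) (φ : Formula) : Formula

namespace Term

/-- All function symbols of the term belong to `L`. -/
def InLang (L : Lang) : Term → Prop
  | var _ => True
  | app k i ts => (k, i) ∈ L.funs ∧ ∀ j, (ts j).InLang L

/-- The variable `x` occurs in the term. -/
def Occurs (x : ℕ) : Term → Prop
  | var y => x = y
  | app _ _ ts => ∃ j, (ts j).Occurs x

/-- Replace the variable `x` by the term `t`. -/
def subst (x : ℕ) (t : Term) : Term → Term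
  | var y => if y = x then t else var y
  | app k i ts => app k i (fun j => Term.subst x t (ts j))

/-- Gödel number. -/
def code : Term → ℕ
  | var x => Nat.pair 0 x
  | app k i ts =>
      Nat.pair 1 (Nat.pair k (Nat.pair i (Encodable.encode (List.ofFn fun j => (ts j).code))))

end Term

/-- Gödel number of a rational in `[0, 1]`. -/
def UnitRat.code (r : UnitRat) : ℕ := Nat.pair r.1.num.toNat r.1.den

namespace Formula

/-- Falsity, the truth constant of value 1. -/
def bot : Formula := const ⟨1, zero_le_one, le_rfl⟩

def neg (φ : Formula) : Formula := imp φ bot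

/-- Strong conjunction, interpreted by `min (x + y) 1`. -/
def oplus (φ ψ : Formula) : Formula := neg (imp φ (neg ψ))

/-- Disjunction, interpreted by `min x y`. -/
def or (φ ψ : Formula) : Formula := imp (imp φ ψ) ψ

def iff (φ ψ : Formula) : Formula := oplus (imp φ ψ) (imp ψ φ)

/-- All symbols of the formula belong to `L`. -/
def InLang (L : Lang) : Formula → Prop
  | const _ => True
  | rel k i ts => (k, i) ∈ L.rels ∧ ∀ j, (ts j).InLang L
  | imp φ ψ => φ.InLang L ∧ ψ.InLang L
  | all _ φ => φ.InLang L

/-- The variable `x` occurs free in the formula. -/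
def Free (x : ℕ) : Formula → Prop
  | const _ => False
  | rel _ _ ts => ∃ j, (ts j).Occurs x
  | imp φ ψ => φ.Free x ∨ ψ.Free x
  | all y φ => x ≠ y ∧ φ.Free x

def IsSentence (φ : Formula) : Prop := ∀ x, ¬ φ.Free x

/-- Replace the free occurrences of the variable `x` by the term `t`. -/
def subst (x : ℕ) (t : Term) : Formula → Formula
  | const r => const r
  | rel k i ts => rel k i (fun j => Term.subst x t (ts j))
  | imp φ ψ => imp (φ.subst x t) (ψ.subst x t)
  | all y φ => if y = x then all y φ else all y (φ.subst x t)

/-- No variable of `t` becomes bound when `t` is substituted for `x`. -/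
def FreeFor (x : ℕ) (t : Term) : Formula → Prop
  | const _ => True
  | rel _ _ _ => True
  | imp φ ψ => φ.FreeFor x t ∧ ψ.FreeFor x t
  | all y φ => ¬ (all y φ).Free x ∨ (¬ t.Occurs y ∧ φ.FreeFor x t)

/-- Formulas of plain first-order Łukasiewicz logic: no truth constant other than falsity. -/
def IsLukasiewicz : Formula → Prop
  | const r => r.1 = 1
  | rel _ _ _ => True
  | imp φ ψ => φ.IsLukasiewicz ∧ ψ.IsLukasiewicz
  | all _ φ => φ.IsLukasiewicz

/-- Gödel number. -/
def code : Formula → ℕ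
  | const r => Nat.pair 0 r.code
  | rel k i ts =>
      Nat.pair 1 (Nat.pair k (Nat.pair i (Encodable.encode (List.ofFn fun j => (ts j).code))))
  | imp φ ψ => Nat.pair 2 (Nat.pair φ.code ψ.code)
  | all x φ => Nat.pair 3 (Nat.pair x φ.code)

end Formula

/-! ### Provability -/

open Formula in
/-- `Provable L T φ`: there is a proof of `φ` from the axioms `T` in rational Pavelka logic over
the language `L`; all formulas and terms that occur in the proof belong to `L`. -/
inductive Provable (L : Lang) (T : Set Formula) : Formula → Prop
  | hyp {φ} : φ ∈ T → φ.InLang L → Provable L T φ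
  | ax1 {φ ψ} : φ.InLang L → ψ.InLang L → Provable L T (imp φ (imp ψ φ))
  | ax2 {φ ψ σ} : φ.InLang L → ψ.InLang L → σ.InLang L →
      Provable L T (imp (imp φ ψ) (imp (imp ψ σ) (imp φ σ)))
  | ax3 {φ ψ} : φ.InLang L → ψ.InLang L →
      Provable L T (imp (imp (imp φ ψ) ψ) (imp (imp ψ φ) φ))
  | ax4 {φ ψ} : φ.InLang L → ψ.InLang L →
      Provable L T (imp (imp (imp φ bot) (imp ψ bot)) (imp ψ φ))
  | all1 {φ x t} : φ.InLang L → t.InLang L → φ.FreeFor x t →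
      Provable L T (imp (all x φ) (φ.subst x t))
  | all2 {φ ψ x} : φ.InLang L → ψ.InLang L → ¬ φ.Free x →
      Provable L T (imp (all x (imp φ ψ)) (imp φ (all x ψ)))
  | axR (r s : UnitRat) :
      Provable L T (iff (imp (const r) (const s)) (const (UnitRat.tsub s r)))
  | mp {φ ψ} : Provable L T φ → Provable L T (imp φ ψ) → Provable L T ψ
  | gen {φ} (x : ℕ) : Provable L T φ → Provable L T (all x φ)

/-! ### Theories -/

/-- A theory: a language and a set of formulas of that language. -/
structure Theory where
  lang : Lang
  axioms : Set Formula
  inLang : ∀ φ ∈ axioms, φ.InLang lang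

namespace Theory

def Proves (T : Theory) (φ : Formula) : Prop := Provable T.lang T.axioms φ

def Consistent (T : Theory) : Prop := ¬ T.Proves Formula.bot

/-- The language is computably given and the set of axioms is computably enumerable. -/
def ComputablyAxiomatizable (T : Theory) : Prop :=
  T.lang.ComputablyGiven ∧ REPred (fun n : ℕ => ∃ φ ∈ T.axioms, φ.code = n)

/-- Any two sentences of the language are comparable. -/
def LinearComplete (T : Theory) : Prop :=
  ∀ φ ψ : Formula, φ.InLang T.lang → ψ.InLang T.lang → φ.IsSentence → ψ.IsSentence →
    T.Proves (Formula.imp φ ψ) ∨ T.Proves (Formula.imp ψ φ)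

/-- `T'` extends `T`: its language contains that of `T`, and it proves the axioms of `T`. -/
def Extends (T' T : Theory) : Prop :=
  T.lang.funs ⊆ T'.lang.funs ∧ T.lang.rels ⊆ T'.lang.rels ∧ ∀ φ ∈ T.axioms, T'.Proves φ

/-- A theory of plain Łukasiewicz logic: its axioms use no truth constant other than falsity. -/
def IsLukasiewicz (T : Theory) : Prop := ∀ φ ∈ T.axioms, φ.IsLukasiewicz

/-- A classical theory: it proves excluded middle for every formula of its language in which
no truth constant other than falsity occurs. -/
def Classical (T : Theory) : Prop :=
  ∀ φ : Formula, φ.InLang T.lang → φ.IsLukasiewicz → T.Proves (Formula.or φ (Formula.neg φ))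

end Theory

/-! ### Standard structures -/

/-- A standard structure on `M`: relations take values in the real unit interval. All symbols are
interpreted; the ones outside the language under consideration play no role. -/
structure Interp (M : Type u) where
  fn : (k i : ℕ) → (Fin k → M) → M
  rel : (k i : ℕ) → (Fin k → M) → unitInterval

def Term.eval {M : Type u} (S : Interp M) (v : ℕ → M) : Term → M
  | .var x => v x
  | .app k i ts => S.fn k i (fun j => (ts j).eval S v)

/-- The truth degree of a formula under the evaluation `v` (0 is true, 1 is false). The supremum
is taken over a family of reals in `[0, 1]`. -/
noncomputable def Formula.eval {M : Type u} (S : Interp M) : Formula → (ℕ → M) → ℝ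
  | .const r, _ => (r.1 : ℝ)
  | .rel k i ts, v => (S.rel k i (fun j => (ts j).eval S v) : ℝ)
  | .imp φ ψ, v => max (ψ.eval S v - φ.eval S v) 0
  | .all x φ, v => ⨆ a : M, φ.eval S (Function.update v x a)

/-- The pair of the structure and the evaluation is a model of `T`. -/
def Interp.Models {M : Type u} (S : Interp M) (v : ℕ → M) (T : Theory) : Prop :=
  ∀ φ ∈ T.axioms, φ.eval S v = 0

/-- The interval `[p, q]` approximates the maximal element `{a}` of the domain of closed
subintervals of `[0, 1]`: the number `a` lies in the interior of `[p, q]` relative to `[0, 1]`. -/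
def WayBelow (p q : UnitRat) (a : ℝ) : Prop :=
  (((p.1 : ℚ) : ℝ) < a ∨ p.1 = 0) ∧ (a < ((q.1 : ℚ) : ℝ) ∨ q.1 = 1)

/-- The elementary diagram of the structure over the elements enumerated by `e`. A formula of `L`
with parameters is a formula `φ` of `L` with a list `s` of numbers: the variable `x` takes the value
`e n`, where `n` is the entry of `s` at position `x` (0 beyond the end of the list). The diagram
lists the rational intervals that approximate its truth degree. -/
def Interp.Diagram {M : Type u} (S : Interp M) (L : Lang) (e : ℕ → M) :
    ℕ × List ℕ × ℕ × ℕ → Prop :=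
  fun z => ∃ (φ : Formula) (p q : UnitRat), φ.InLang L ∧
    z.1 = φ.code ∧ z.2.2.1 = p.code ∧ z.2.2.2 = q.code ∧
    WayBelow p q (φ.eval S (fun x => e (z.2.1.getD x 0)))

/-- `S` is decidable as a structure for `L`, on a complete metric space (a countable structure being
one with the discrete metric): the operations and relations of `L` are continuous, and for some
enumeration of a dense set the elementary diagram over it is computably enumerable. -/
def Interp.IsDecidable {M : Type u} [MetricSpace M] (S : Interp M) (L : Lang) : Prop :=
  CompleteSpace M ∧
  (∀ k i, (k, i) ∈ L.funs → Continuous (S.fn k i)) ∧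
  (∀ k i, (k, i) ∈ L.rels → Continuous (S.rel k i)) ∧
  ∃ e : ℕ → M, DenseRange e ∧ REPred (S.Diagram L e)

def Theory.HasDecidableModel (T : Theory) : Prop :=
  ∃ (M : Type u) (_ : MetricSpace M) (S : Interp M) (v : ℕ → M),
    S.IsDecidable T.lang ∧ S.Models v T

end RPL

/-! Let A₀ and A₁ be the sets of programs that output 0, respectively 1, on their own code. They are
disjoint, r.e. and recursively inseparable; `selfOutput_inseparable` puts this as follows: ℕ is not
the union of r.e. sets U and V with U disjoint from A₁ and V disjoint from A₀. The theory
`inseparableTheory` asserts P(cₙ) for n in A₀, denies it for n in A₁, and has excluded middle for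
all formulas without truth constants other than ⊥. A two-valued structure on ℕ satisfies it, so it
is consistent by soundness (`Provable.eval_eq_zero`).

Either kind of object to be excluded yields a forbidden cover. In a decidable model, "the degree of
P(cₙ) is below 2/3" and "it is above 1/3" are r.e. and together exhaust all n, while the axioms
force degree 0 on A₀ and 1 on A₁. In a linear-complete extension, ¬P(cₙ) → P(cₙ) or P(cₙ) → ¬P(cₙ)
is provable for every n; consistency rules out the second on A₀ and the first on A₁.

The second argument needs the theorems of a computably axiomatizable theory to be r.e., which takes
up most of the file. Substitution and proof are given as r.e. systems of rules on Gödel numbers, and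
`REPred.derivable` shows that such a system derives an r.e. set. -/

/-! ### Closure properties and enumerations of r.e. predicates. -/

namespace REPred

variable {α β : Type*} [Primcodable α] [Primcodable β]

theorem comp {p : β → Prop} {f : α → β} (hp : REPred p) (hf : Computable f) :
    REPred fun a => p (f a) :=
  Partrec.comp hp hf

theorem and {p q : α → Prop} (hp : REPred p) (hq : REPred q) : REPred fun a => p a ∧ q a := by
  have h : Partrec fun a => (Part.assert (p a) fun _ => Part.some ()).bind fun _ =>
      Part.assert (q a) fun _ => Part.some () :=
    Partrec.bind hp (Partrec.comp hq Computable.fst).to₂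
  refine h.dom_re.of_eq fun a => ?_
  simp [Part.dom_iff_mem]

theorem or {p q : α → Prop} (hp : REPred p) (hq : REPred q) : REPred fun a => p a ∨ q a := by
  obtain ⟨k, hk, H⟩ := Partrec.merge' hp hq
  refine hk.dom_re.of_eq fun a => ?_
  rw [(H a).2]
  simp [Part.assert]

theorem exists_nat {q : ℕ × α → Prop} (hq : ComputablePred q) : REPred fun a => ∃ s, q (s, a) := by
  obtain ⟨_, hq⟩ := hq
  have h : Partrec fun a : α => Nat.rfind fun s => Part.some (decide (q (s, a))) :=
    Partrec.rfind (hq.comp (Computable.pair Computable.snd Computable.fst)).to₂.partrec₂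
  refine h.dom_re.of_eq fun a => Nat.rfind_dom.trans ?_
  constructor
  · rintro ⟨s, hs, -⟩
    exact ⟨s, by simpa using hs⟩
  · rintro ⟨s, hs⟩
    exact ⟨s, by simpa using hs, fun _ => trivial⟩

/-- Every r.e. predicate is the projection of a primitive recursive one. -/
theorem exists_primrecPred {p : α → Prop} (hp : REPred p) :
    ∃ q : ℕ × α → Prop, PrimrecPred q ∧ ∀ a, p a ↔ ∃ s, q (s, a) := by
  obtain ⟨c, hc⟩ := Nat.Partrec.Code.exists_code.1 hp
  have hdom : ∀ a, p a ↔ (c.eval (Encodable.encode a)).Dom := fun a => by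
    rw [hc]; simp [Part.assert]
  refine ⟨fun z => (Nat.Partrec.Code.evaln z.1 c (Encodable.encode z.2)).isSome, ?_, fun a => ?_⟩
  · have h1 : Primrec fun z : ℕ × α => Nat.Partrec.Code.evaln z.1 c (Encodable.encode z.2) :=
      Nat.Partrec.Code.primrec_evaln.comp (Primrec.pair (Primrec.pair Primrec.fst (Primrec.const c))
        (Primrec.encode.comp Primrec.snd))
    exact (Primrec.eq.comp (Primrec.option_isSome.comp h1) (Primrec.const true))
  · rw [hdom, Part.dom_iff_mem]
    simp_rw [Nat.Partrec.Code.evaln_complete, Option.isSome_iff_exists, Option.mem_def]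
    exact exists_comm

/-- Every r.e. predicate is enumerated by a primitive recursive function. -/
theorem exists_enum {p : α → Prop} (hp : REPred p) :
    ∃ g : ℕ → Option α, Primrec g ∧ ∀ a, p a ↔ ∃ n, g n = some a := by
  classical
  obtain ⟨q, hq, H⟩ := hp.exists_primrecPred
  -- The index `n` is read as a pair of a stage and a candidate, which is output if the stage
  -- witnesses it.
  refine ⟨fun n => (Encodable.decode (α := ℕ × α) n).bind
    fun z => if q z then some z.2 else none, ?_, fun a => ?_⟩
  · refine Primrec.option_bind Primrec.decode (Primrec.ite (hq.comp Primrec.snd)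
      (Primrec.option_some.comp (Primrec.snd.comp Primrec.snd)) (Primrec.const none)).to₂
  · rw [H]
    constructor
    · rintro ⟨s, hs⟩
      exact ⟨Encodable.encode (s, a), by simp [Encodable.encodek, hs]⟩
    · rintro ⟨n, hn⟩
      obtain ⟨⟨s, b⟩, -, h⟩ := Option.bind_eq_some_iff.1 hn
      split_ifs at h with hs
      cases h
      exact ⟨s, hs⟩

theorem of_enum {p : α → Prop} {g : ℕ → Option α} (hg : Primrec g)
    (H : ∀ a, p a ↔ ∃ n, g n = some a) : REPred p :=
  (exists_nat (q := fun z => g z.1 = some z.2) (PrimrecPred.computablePred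
    (Primrec.eq.comp (hg.comp Primrec.fst) (Primrec.option_some.comp Primrec.snd)))).of_eq
      fun a => (H a).symm

theorem exists_snd {p : α × β → Prop} (hp : REPred p) : REPred fun a => ∃ b, p (a, b) := by
  obtain ⟨g, hg, H⟩ := hp.exists_enum
  refine of_enum (g := fun n => (g n).map Prod.fst)
    (Primrec.option_map hg (Primrec.fst.comp Primrec.snd).to₂) fun a => ?_
  simp only [H, Option.map_eq_some_iff, Prod.exists, exists_and_right, exists_eq_right]
  exact exists_comm

theorem image {p : α → Prop} {f : α → β} (hp : REPred p) (hf : Primrec f) :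
    REPred fun b => ∃ a, p a ∧ f a = b :=
  exists_snd (p := fun z : β × α => p z.2 ∧ f z.2 = z.1) <|
    (hp.comp Computable.snd).and <| PrimrecPred.computablePred
      (Primrec.eq.comp (hf.comp Primrec.snd) Primrec.fst) |>.to_re

theorem range {f : α → β} (hf : Primrec f) : REPred fun b => ∃ a, f a = b :=
  (image (p := fun _ => True) (PrimrecPred.computablePred
    (Primrec.eq.comp (Primrec.const 0) (Primrec.const 0)) |>.to_re.of_eq (by simp)) hf).of_eq
      (by simp)

end REPred

/-! ### Sets derivable by an r.e. system of rules. -/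

/-- The set of facts derivable by the rules `R`, which relate lists of premises to conclusions. -/
inductive Derivable {α : Type*} (R : List α × α → Prop) : α → Prop
  | intro {ps : List α} {a : α} : R (ps, a) → (∀ b ∈ ps, Derivable R b) → Derivable R a

namespace Derivable

variable {α : Type*}

open Classical in
/-- Apply the enumerated rules with the given indices one after the other. -/
noncomputable def run (g : ℕ → Option (List α × α)) (seeds : List ℕ) : List α :=
  seeds.foldr (fun n acc => (g n).elim acc fun r =>
    if ∀ b ∈ r.1, b ∈ acc then r.2 :: acc else acc) []

/-- Indices are used from the right end, so `t` is run before `s`. Facts are never discarded, and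
extra facts can only let more rules of `s` fire. -/
theorem run_append (g : ℕ → Option (List α × α)) (s t : List ℕ) :
    (∀ a ∈ run g t, a ∈ run g (s ++ t)) ∧ ∀ a ∈ run g s, a ∈ run g (s ++ t) := by
  induction s with
  | nil => simp [run]
  | cons n s ih =>
    have hc : ∀ l, run g (n :: l) = (g n).elim (run g l) fun r =>
        open Classical in if ∀ b ∈ r.1, b ∈ run g l then r.2 :: run g l else run g l :=
      fun _ => rfl
    rw [List.cons_append, hc, hc]
    cases g n with
    | none => exact ih
    | some r =>
      simp only [Option.elim_some]
      constructor
      · intro a ha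
        have := ih.1 a ha
        split_ifs <;> simp [this]
      · intro a ha
        by_cases h : ∀ b ∈ r.1, b ∈ run g s
        · rw [if_pos h] at ha
          rw [if_pos fun b hb => ih.2 b (h b hb)]
          rcases List.mem_cons.1 ha with rfl | ha
          · simp
          · exact List.mem_cons_of_mem _ (ih.2 a ha)
        · rw [if_neg h] at ha
          have := ih.2 a ha
          split_ifs <;> simp [this]

/-- A derivation tree is flattened into a list of rule indices: the lists for the finitely many
premises are concatenated, and the index of the last rule goes to the head, where it is applied
last. -/
theorem iff_mem_run {R : List α × α → Prop} {g : ℕ → Option (List α × α)}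
    (H : ∀ r, R r ↔ ∃ n, g n = some r) (a : α) : Derivable R a ↔ ∃ seeds, a ∈ run g seeds := by
  constructor
  · intro h
    induction h with
    | @intro ps a hr _ ih =>
      obtain ⟨n, hn⟩ := (H _).1 hr
      have : ∃ seeds, ∀ b ∈ ps, b ∈ run g seeds := by
        clear hr hn
        induction ps with
        | nil => exact ⟨[], by simp⟩
        | cons b ps ihp =>
          obtain ⟨s, hs⟩ := ihp (fun c hc => by simp_all) (fun c hc => ih c (by simp [hc]))
          obtain ⟨t, ht⟩ := ih b (by simp)
          refine ⟨s ++ t, fun c hc => ?_⟩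
          rcases List.mem_cons.1 hc with rfl | hc
          · exact (run_append g s t).1 _ ht
          · exact (run_append g s t).2 _ (hs c hc)
      obtain ⟨s, hs⟩ := this
      refine ⟨n :: s, ?_⟩
      simp only [run, List.foldr_cons, hn, Option.elim_some]
      exact if_pos (α := List α) hs ▸ List.mem_cons_self
  · rintro ⟨s, hs⟩
    induction s generalizing a with
    | nil => simp [run] at hs
    | cons n s ih =>
      change a ∈ (g n).elim _ _ at hs
      rcases hn : g n with _ | r
      · rw [hn] at hs
        exact ih a hs
      · rw [hn, Option.elim_some] at hs
        split_ifs at hs with h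
        · rcases List.mem_cons.1 hs with rfl | hs
          · exact .intro (ps := r.1) ((H _).2 ⟨n, hn⟩) fun b hb => ih b (h b hb)
          · exact ih a hs
        · exact ih a hs

theorem primrec_run [Primcodable α] {g : ℕ → Option (List α × α)} (hg : Primrec g) :
    Primrec (run g) := by
  classical
  have hex : PrimrecRel fun (l : List α) (b : α) => ∃ a ∈ l, a = b :=
    PrimrecRel.exists_mem_list Primrec.eq
  have hmem : PrimrecPred fun z : α × List α => ∃ a ∈ z.2, a = z.1 :=
    hex.comp Primrec.snd Primrec.fst
  have hall : PrimrecRel fun (l acc : List α) => ∀ b ∈ l, b ∈ acc :=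
    PrimrecRel.forall_mem_list (R := fun b acc => b ∈ acc) (hmem.of_eq fun z => by simp)
  have key : Primrec fun z : List ℕ × ℕ × List α =>
      ((g z.2.1).map fun r => if ∀ b ∈ r.1, b ∈ z.2.2 then r.2 :: z.2.2 else z.2.2).getD z.2.2 := by
    refine Primrec.option_getD.comp (Primrec.option_map
      (hg.comp (Primrec.fst.comp Primrec.snd)) ?_) (Primrec.snd.comp Primrec.snd)
    have hacc : Primrec fun w : (List ℕ × ℕ × List α) × (List α × α) => w.1.2.2 :=
      Primrec.snd.comp (Primrec.snd.comp Primrec.fst)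
    exact (Primrec.ite (hall.comp (Primrec.fst.comp Primrec.snd) hacc)
      (Primrec.list_cons.comp (Primrec.snd.comp Primrec.snd) hacc) hacc).to₂
  refine (Primrec.list_foldr (Primrec.id (α := List ℕ)) (Primrec.const ([] : List α))
    key.to₂).of_eq fun s => ?_
  refine congrArg (fun f => List.foldr f [] s) (funext₂ fun n acc => ?_)
  cases g n <;> rfl

end Derivable

/-- Checking a given list of rule indices is primitive recursive, so derivability is the projection
of a decidable relation. -/
theorem REPred.derivable {α : Type*} [Primcodable α] {R : List α × α → Prop} (hR : REPred R) :
    REPred (Derivable R) := by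
  obtain ⟨g, hg, H⟩ := hR.exists_enum
  have hmem : PrimrecRel fun (l : List α) (b : α) => ∃ a ∈ l, a = b :=
    PrimrecRel.exists_mem_list Primrec.eq
  have : REPred fun z : α × List ℕ => ∃ a ∈ Derivable.run g z.2, a = z.1 :=
    (PrimrecPred.computablePred (hmem.comp ((Derivable.primrec_run hg).comp Primrec.snd)
      Primrec.fst)).to_re
  exact this.exists_snd.of_eq fun a => by simp [Derivable.iff_mem_run H]

/-! ### Recursively inseparable sets. -/

open Nat.Partrec (Code)

/-- The self-halting problem with output `k`. -/
def SelfOutput (k n : ℕ) : Prop := k ∈ (Denumerable.ofNat Code n).eval n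

theorem rePred_selfOutput (k : ℕ) : REPred (SelfOutput k) := by
  have h : Partrec fun n : ℕ => ((Denumerable.ofNat Code n).eval n).bind fun m =>
      if m = k then Part.some () else Part.none := by
    refine Partrec.bind (Code.eval_part.comp (Computable.ofNat Code) Computable.id) ?_
    have : Computable fun z : ℕ × ℕ => decide (z.2 = k) :=
      (Primrec.eq.comp Primrec.snd (Primrec.const k)).decide.to_comp
    refine (Partrec.cond this (Computable.const ()).partrec Partrec.none).of_eq fun z => ?_
    by_cases hz : z.2 = k <;> simp [hz]
  refine h.dom_re.of_eq fun n => ?_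
  simp only [Part.dom_iff_mem, Part.mem_bind_iff, SelfOutput]
  constructor
  · rintro ⟨_, m, hm, hk⟩
    split_ifs at hk with h
    · exact h ▸ hm
    · simp at hk
  · exact fun h => ⟨(), k, h, by simp⟩

theorem not_selfOutput {k l n : ℕ} (h : k ≠ l) (hk : SelfOutput k n) : ¬ SelfOutput l n :=
  fun hl => h (Part.mem_unique hk hl)

/-- The self-halting sets for two outputs cannot be separated by an r.e. cover of the naturals. -/
theorem selfOutput_inseparable {U V : ℕ → Prop} (hU : REPred U) (hV : REPred V)
    (hUV : ∀ n, U n ∨ V n) (h0 : ∀ n, SelfOutput 0 n → ¬ V n) (h1 : ∀ n, SelfOutput 1 n → ¬ U n) :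
    False := by
  -- Diagonal program: search for its input in `U` and `V` in parallel, answering 1 if found in `U`
  -- and 0 if found in `V`. On its own code either answer contradicts the assumption on that set.
  obtain ⟨k, hk, H⟩ := Partrec.merge' (hU.map (Computable.const 1).to₂)
    (hV.map (Computable.const 0).to₂)
  obtain ⟨c, hc⟩ := Code.exists_code.1 (Partrec.nat_iff.1 hk)
  have hdom : (k (Encodable.encode c)).Dom := by
    rw [(H _).2]
    simpa [Part.assert] using hUV _
  obtain ⟨m, hm⟩ := Part.dom_iff_mem.1 hdom
  have hs : SelfOutput m (Encodable.encode c) := by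
    rw [SelfOutput, Denumerable.ofNat_encode, hc]
    exact hm
  have := (H _).1 m hm
  simp only [Part.mem_map_iff, Part.mem_assert_iff] at this
  rcases this with ⟨_, ⟨hu, -⟩, rfl⟩ | ⟨_, ⟨hv, -⟩, rfl⟩
  · exact h1 _ hs hu
  · exact h0 _ hs hv

/-! ### Injectivity of Gödel numbers; substitution and free variables. -/

namespace RPL

namespace Term

theorem code_injective : Function.Injective code := by
  intro s
  induction s with
  | var x =>
    intro t h
    cases t with
    | var y => simpa [code] using h
    | app k i ts => simp [code] at h
  | app k i ss ih =>
    intro t h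
    cases t with
    | var y => simp [code] at h
    | app l j ts =>
      simp only [code, Nat.pair_eq_pair, true_and] at h
      obtain ⟨rfl, rfl, h⟩ := h
      have h := List.ofFn_injective (Encodable.encode_injective h)
      simp only [app.injEq, heq_eq_eq, true_and]
      exact funext fun m => ih m (congrFun h m)

theorem subst_var_self (x : ℕ) (t : Term) : subst x (var x) t = t := by
  induction t with
  | var y => by_cases h : y = x <;> simp [subst, h]
  | app k i ts ih => simp [subst, ih]

theorem subst_of_not_occurs {x : ℕ} (u : Term) {t : Term} (h : ¬ t.Occurs x) :
    subst x u t = t := by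
  induction t with
  | var y => exact if_neg fun e : y = x => h e.symm
  | app k i ts ih =>
    have h : ∀ j, ¬ (ts j).Occurs x := fun j hj => h ⟨j, hj⟩
    simp [subst, ih _ (h _)]

/-- The variable `x + 1` is simply one that differs from `x`. With the converse
`subst_of_not_occurs`, non-occurrence becomes a fixed-point condition that positive rules can
express. -/
theorem not_occurs_of_subst_succ {x : ℕ} {t : Term} (h : subst x (var (x + 1)) t = t) :
    ¬ t.Occurs x := by
  induction t with
  | var y =>
    rintro rfl
    simp [subst] at h
  | app k i ts ih =>
    simp only [subst, app.injEq, heq_eq_eq, true_and] at h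
    rintro ⟨j, hj⟩
    exact ih j (congrFun h j) hj

end Term

/-- Numerators are nonnegative, so `toNat` loses nothing. -/
theorem UnitRat.code_injective : Function.Injective UnitRat.code := by
  intro r s h
  simp only [UnitRat.code, Nat.pair_eq_pair] at h
  have hr := Rat.num_nonneg.2 r.2.1
  have hs := Rat.num_nonneg.2 s.2.1
  exact Subtype.ext (Rat.ext (by omega) h.2)

namespace Formula

theorem code_injective : Function.Injective code := by
  intro φ
  induction φ with
  | const r =>
    intro ψ h
    cases ψ <;> simp [code] at h
    rw [UnitRat.code_injective h]
  | rel k i ss =>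
    intro ψ h
    cases ψ <;> simp only [code, Nat.pair_eq_pair, OfNat.one_ne_ofNat, one_ne_zero, false_and, true_and] at h
    obtain ⟨rfl, rfl, h⟩ := h
    have h := List.ofFn_injective (Encodable.encode_injective h)
    simp only [rel.injEq, heq_eq_eq, true_and]
    exact funext fun m => Term.code_injective (congrFun h m)
  | imp φ₁ φ₂ ih₁ ih₂ =>
    intro ψ h
    cases ψ <;> simp [code] at h
    rw [ih₁ h.1, ih₂ h.2]
  | all x φ ih =>
    intro ψ h
    cases ψ <;> simp [code] at h
    rw [h.1, ih h.2]

theorem subst_var_self (x : ℕ) (φ : Formula) : φ.subst x (.var x) = φ := by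
  induction φ with
  | const r => rfl
  | rel k i ts => simp [subst, Term.subst_var_self]
  | imp φ ψ ih₁ ih₂ => simp [subst, ih₁, ih₂]
  | all y φ ih => simp [subst, ih]

theorem freeFor_of_not_free {x : ℕ} (u : Term) {φ : Formula} (h : ¬ φ.Free x) :
    φ.FreeFor x u := by
  induction φ with
  | const r => trivial
  | rel k i ts => trivial
  | imp φ ψ ih₁ ih₂ => exact ⟨ih₁ fun h' => h (.inl h'), ih₂ fun h' => h (.inr h')⟩
  | all y φ ih => exact .inl h

theorem subst_of_not_free {x : ℕ} (u : Term) {φ : Formula} (h : ¬ φ.Free x) :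
    φ.subst x u = φ := by
  induction φ with
  | const r => rfl
  | rel k i ts =>
    simp only [Free, not_exists] at h
    simp [subst, Term.subst_of_not_occurs u (h _)]
  | imp φ ψ ih₁ ih₂ =>
    simp only [Free, not_or] at h
    simp [subst, ih₁ h.1, ih₂ h.2]
  | all y φ ih =>
    by_cases hy : y = x
    · simp [subst, hy]
    · simp only [Free, not_and] at h
      simp [subst, ih (h (Ne.symm hy))]

theorem freeFor_var_self (x : ℕ) (φ : Formula) : φ.FreeFor x (.var x) := by
  induction φ with
  | const r => trivial
  | rel k i ts => trivial
  | imp φ ψ ih₁ ih₂ => exact ⟨ih₁, ih₂⟩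
  | all y φ ih =>
    by_cases hy : x = y
    · exact .inl fun h => h.1 hy
    · exact .inr ⟨fun h => hy h.symm, ih⟩

theorem not_free_of_subst_succ {x : ℕ} {φ : Formula} (h : φ.subst x (.var (x + 1)) = φ) :
    ¬ φ.Free x := by
  induction φ with
  | const r => exact id
  | rel k i ts =>
    simp only [subst, rel.injEq, heq_eq_eq, true_and] at h
    rintro ⟨j, hj⟩
    exact Term.not_occurs_of_subst_succ (congrFun h j) hj
  | imp φ ψ ih₁ ih₂ =>
    simp only [subst, imp.injEq] at h
    exact fun h' => h'.elim (ih₁ h.1) (ih₂ h.2)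
  | all y φ ih =>
    rintro ⟨hne, hf⟩
    rw [subst, if_neg (Ne.symm hne)] at h
    exact ih (by simpa using h) hf

/-- All truth constants of the formula satisfy `C`. -/
def ConstsIn (C : UnitRat → Prop) : Formula → Prop
  | const r => C r
  | rel _ _ _ => True
  | imp φ ψ => φ.ConstsIn C ∧ ψ.ConstsIn C
  | all _ φ => φ.ConstsIn C

/-- The trivial condition serves the proof rules of the full logic; the condition of having value 1
serves the excluded-middle axioms. -/
theorem constsIn_true (φ : Formula) : φ.ConstsIn fun _ => True := by
  induction φ with
  | const r => trivial
  | rel k i ts => trivial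
  | imp φ ψ ih₁ ih₂ => exact ⟨ih₁, ih₂⟩
  | all y φ ih => exact ih

theorem constsIn_one_iff (φ : Formula) : (φ.ConstsIn fun r => r.1 = 1) ↔ φ.IsLukasiewicz := by
  induction φ with
  | const r => rfl
  | rel k i ts => rfl
  | imp φ ψ ih₁ ih₂ => exact and_congr ih₁ ih₂
  | all y φ ih => exact ih

end Formula

/-! ### Codes of syntactic operations -/

namespace Code

def var (x : ℕ) : ℕ := Nat.pair 0 x
def app (k i l : ℕ) : ℕ := Nat.pair 1 (Nat.pair k (Nat.pair i l))
-- Matches the `Encodable` code of a nonempty list of numbers; the empty list has code 0.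
def cons (t l : ℕ) : ℕ := Nat.succ (Nat.pair t l)
def const (r : ℕ) : ℕ := Nat.pair 0 r
def imp (f g : ℕ) : ℕ := Nat.pair 2 (Nat.pair f g)
def all (x f : ℕ) : ℕ := Nat.pair 3 (Nat.pair x f)

/-- A fact about codes: a tag with five numbers. -/
abbrev Fact : Type := ℕ × ℕ × ℕ × ℕ × ℕ × ℕ

/-- Substituting the term `u` for `x` turns the term `t` into `t'`. -/
def termFact (x u t t' : ℕ) : Fact := (0, x, u, 0, t, t')

/-- Substituting the term `u` for `x` turns the list `l` of `k` terms into `l'`. -/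
def listFact (x u k l l' : ℕ) : Fact := (1, x, u, k, l, l')

/-- The term `u` is free for `x` in the formula `f`, and substituting it turns `f` into `f'`. -/
def formulaFact (x u f f' : ℕ) : Fact := (2, x, u, 0, f, f')

-- Automation for primitive recursive expressions.

attribute [fun_prop] Primrec

section

variable {α β γ : Type*} [Primcodable α] [Primcodable β] [Primcodable γ]

@[fun_prop] theorem primrec_id : Primrec fun a : α => a := Primrec.id

@[fun_prop] theorem primrec_const (b : β) : Primrec fun _ : α => b := Primrec.const b

@[fun_prop] theorem primrec_comp {f : β → γ} {g : α → β} (hf : Primrec f) (hg : Primrec g) :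
    Primrec fun a => f (g a) := hf.comp hg

@[fun_prop] theorem primrec_mk {f : α → β} {g : α → γ} (hf : Primrec f) (hg : Primrec g) :
    Primrec fun a => (f a, g a) := hf.pair hg

@[fun_prop] theorem primrec_fst {f : α → β × γ} (hf : Primrec f) : Primrec fun a => (f a).1 :=
  Primrec.fst.comp hf

@[fun_prop] theorem primrec_snd {f : α → β × γ} (hf : Primrec f) : Primrec fun a => (f a).2 :=
  Primrec.snd.comp hf

@[fun_prop] theorem primrec_list_cons {f : α → β} {g : α → List β} (hf : Primrec f)
    (hg : Primrec g) : Primrec fun a => f a :: g a := Primrec.list_cons.comp hf hg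

@[fun_prop] theorem primrec_natPair {f g : α → ℕ} (hf : Primrec f) (hg : Primrec g) :
    Primrec fun a => Nat.pair (f a) (g a) := Primrec₂.natPair.comp hf hg

@[fun_prop] theorem primrec_unpair {f : α → ℕ} (hf : Primrec f) :
    Primrec fun a => Nat.unpair (f a) := Primrec.unpair.comp hf

@[fun_prop] theorem primrec_succ {f : α → ℕ} (hf : Primrec f) : Primrec fun a => (f a).succ :=
  Primrec.succ.comp hf

@[fun_prop] theorem primrec_add {f g : α → ℕ} (hf : Primrec f) (hg : Primrec g) :
    Primrec fun a => f a + g a := Primrec.nat_add.comp hf hg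

@[fun_prop] theorem primrec_sub {f g : α → ℕ} (hf : Primrec f) (hg : Primrec g) :
    Primrec fun a => f a - g a := Primrec.nat_sub.comp hf hg

@[fun_prop] theorem primrec_mul {f g : α → ℕ} (hf : Primrec f) (hg : Primrec g) :
    Primrec fun a => f a * g a := Primrec.nat_mul.comp hf hg

end

end Code

end RPL

/-! ### Substitution as an r.e. rule system on codes. -/

namespace RPL

namespace Code

/-- The rules deriving the substitution facts over the language with function symbols `F`, relation
symbols `R` and codes of truth constants `C`. That a term or formula belongs to the language is
expressed by substituting a variable for itself, and that a variable does not occur in it by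
substituting another variable for it with no effect. -/
inductive SubstRule (F R : ℕ × ℕ → Prop) (C : ℕ → Prop) : List Fact × Fact → Prop
  | var_ne {x u y} : y ≠ x → SubstRule F R C ([], termFact x u (var y) (var y))
  | var_eq {x u} : SubstRule F R C ([], termFact x u (var x) u)
  | app {x u k i l l'} : F (k, i) →
      SubstRule F R C ([listFact x u k l l'], termFact x u (app k i l) (app k i l'))
  | nil {x u} : SubstRule F R C ([], listFact x u 0 0 0)
  | cons {x u k t t' l l'} : SubstRule F R C ([termFact x u t t', listFact x u k l l'],
      listFact x u (k + 1) (cons t l) (cons t' l'))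
  | const {x u r} : C r → SubstRule F R C ([], formulaFact x u (const r) (const r))
  | rel {x u k i l l'} : R (k, i) →
      SubstRule F R C ([listFact x u k l l'], formulaFact x u (app k i l) (app k i l'))
  | imp {x u f f' g g'} : SubstRule F R C ([formulaFact x u f f', formulaFact x u g g'],
      formulaFact x u (imp f g) (imp f' g'))
  | all_self {x u f} :
      SubstRule F R C ([formulaFact 0 (var 0) f f], formulaFact x u (all x f) (all x f))
  | all_not_occurs {x u y f f'} : y ≠ x →
      SubstRule F R C ([termFact y (var (y + 1)) u u, formulaFact x u f f'],
        formulaFact x u (all y f) (all y f'))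
  | all_not_free {x u y f} :
      SubstRule F R C ([formulaFact x (var (x + 1)) f f], formulaFact x u (all y f) (all y f))

/-- Each constructor contributes the image of an r.e. set of parameters under a primitive recursive
map, and the rule set is the union of these images. -/
theorem rePred_substRule {F R : ℕ × ℕ → Prop} {C : ℕ → Prop} (hF : REPred F) (hR : REPred R)
    (hC : REPred C) : REPred (SubstRule F R C) := by
  have hne : REPred fun a : ℕ × ℕ × ℕ => a.1 ≠ a.2.1 :=
    (PrimrecPred.not (Primrec.eq.comp Primrec.fst
      (Primrec.fst.comp Primrec.snd))).computablePred.to_re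
  have hne' : REPred fun a : ℕ × ℕ × ℕ × ℕ × ℕ => a.1 ≠ a.2.1 :=
    (PrimrecPred.not (Primrec.eq.comp Primrec.fst
      (Primrec.fst.comp Primrec.snd))).computablePred.to_re
  have hsym : ∀ {S : ℕ × ℕ → Prop}, REPred S → REPred fun a : ℕ × ℕ × ℕ × ℕ × ℕ × ℕ =>
      S (a.1, a.2.1) := fun h => h.comp
    (Computable.pair Computable.fst (Computable.fst.comp Computable.snd))
  have h1 := hne.image (f := fun a => (([] : List Fact), termFact a.2.1 a.2.2 (var a.1) (var a.1)))
    (by unfold termFact var; fun_prop)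
  have h2 := REPred.range (f := fun a : ℕ × ℕ => (([] : List Fact), termFact a.1 a.2 (var a.1) a.2))
    (by unfold termFact var; fun_prop)
  have h3 := (hsym hF).image (f := fun a => ([listFact a.2.2.1 a.2.2.2.1 a.1 a.2.2.2.2.1 a.2.2.2.2.2],
    termFact a.2.2.1 a.2.2.2.1 (app a.1 a.2.1 a.2.2.2.2.1) (app a.1 a.2.1 a.2.2.2.2.2)))
    (by unfold termFact listFact app; fun_prop)
  have h4 := REPred.range (f := fun a : ℕ × ℕ => (([] : List Fact), listFact a.1 a.2 0 0 0))
    (by unfold listFact; fun_prop)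
  have h5 := REPred.range (f := fun a : ℕ × ℕ × ℕ × ℕ × ℕ × ℕ × ℕ =>
    ([termFact a.1 a.2.1 a.2.2.2.1 a.2.2.2.2.1,
      listFact a.1 a.2.1 a.2.2.1 a.2.2.2.2.2.1 a.2.2.2.2.2.2],
    listFact a.1 a.2.1 (a.2.2.1 + 1) (cons a.2.2.2.1 a.2.2.2.2.2.1)
      (cons a.2.2.2.2.1 a.2.2.2.2.2.2)))
    (by unfold termFact listFact cons; fun_prop)
  have h6 := (hC.comp Computable.fst).image (f := fun a : ℕ × ℕ × ℕ =>
    (([] : List Fact), formulaFact a.2.1 a.2.2 (const a.1) (const a.1)))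
    (by unfold formulaFact const; fun_prop)
  have h7 := (hsym hR).image (f := fun a => ([listFact a.2.2.1 a.2.2.2.1 a.1 a.2.2.2.2.1 a.2.2.2.2.2],
    formulaFact a.2.2.1 a.2.2.2.1 (app a.1 a.2.1 a.2.2.2.2.1) (app a.1 a.2.1 a.2.2.2.2.2)))
    (by unfold formulaFact listFact app; fun_prop)
  have h8 := REPred.range (f := fun a : ℕ × ℕ × ℕ × ℕ × ℕ × ℕ =>
    ([formulaFact a.1 a.2.1 a.2.2.1 a.2.2.2.1, formulaFact a.1 a.2.1 a.2.2.2.2.1 a.2.2.2.2.2],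
    formulaFact a.1 a.2.1 (imp a.2.2.1 a.2.2.2.2.1) (imp a.2.2.2.1 a.2.2.2.2.2)))
    (by unfold formulaFact imp; fun_prop)
  have h9 := REPred.range (f := fun a : ℕ × ℕ × ℕ =>
    ([formulaFact 0 (var 0) a.2.2 a.2.2], formulaFact a.1 a.2.1 (all a.1 a.2.2) (all a.1 a.2.2)))
    (by unfold formulaFact var all; fun_prop)
  have h10 := hne'.image (f := fun a =>
    ([termFact a.1 (var (a.1 + 1)) a.2.2.1 a.2.2.1, formulaFact a.2.1 a.2.2.1 a.2.2.2.1 a.2.2.2.2],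
      formulaFact a.2.1 a.2.2.1 (all a.1 a.2.2.2.1) (all a.1 a.2.2.2.2)))
    (by unfold formulaFact termFact var all; fun_prop)
  have h11 := REPred.range (f := fun a : ℕ × ℕ × ℕ × ℕ =>
    ([formulaFact a.1 (var (a.1 + 1)) a.2.2.2 a.2.2.2],
      formulaFact a.1 a.2.1 (all a.2.2.1 a.2.2.2) (all a.2.2.1 a.2.2.2)))
    (by unfold formulaFact var all; fun_prop)
  refine (h1.or <| h2.or <| h3.or <| h4.or <| h5.or <| h6.or <| h7.or <| h8.or <| h9.or <|
    h10.or h11).of_eq fun z => ⟨?_, fun h => ?_⟩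
  · rintro (⟨a, h, rfl⟩ | ⟨a, rfl⟩ | ⟨a, h, rfl⟩ | ⟨a, rfl⟩ | ⟨a, rfl⟩ | ⟨a, h, rfl⟩ | ⟨a, h, rfl⟩ |
      ⟨a, rfl⟩ | ⟨a, rfl⟩ | ⟨a, h, rfl⟩ | ⟨a, rfl⟩)
    · exact .var_ne h
    · exact .var_eq
    · exact .app h
    · exact .nil
    · exact .cons
    · exact .const h
    · exact .rel h
    · exact .imp
    · exact .all_self
    · exact .all_not_occurs h
    · exact .all_not_free
  · cases h with
    | var_ne h => exact .inl ⟨(_, _, _), h, rfl⟩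
    | var_eq => exact .inr <| .inl ⟨(_, _), rfl⟩
    | app h => exact .inr <| .inr <| .inl ⟨(_, _, _, _, _, _), h, rfl⟩
    | nil => exact .inr <| .inr <| .inr <| .inl ⟨(_, _), rfl⟩
    | cons => exact .inr <| .inr <| .inr <| .inr <| .inl ⟨(_, _, _, _, _, _, _), rfl⟩
    | const h => exact .inr <| .inr <| .inr <| .inr <| .inr <| .inl ⟨(_, _, _), h, rfl⟩
    | rel h =>
      exact .inr <| .inr <| .inr <| .inr <| .inr <| .inr <| .inl ⟨(_, _, _, _, _, _), h, rfl⟩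
    | imp =>
      exact .inr <| .inr <| .inr <| .inr <| .inr <| .inr <| .inr <| .inl ⟨(_, _, _, _, _, _), rfl⟩
    | all_self =>
      exact .inr <| .inr <| .inr <| .inr <| .inr <| .inr <| .inr <| .inr <| .inl ⟨(_, _, _), rfl⟩
    | all_not_occurs h =>
      exact .inr <| .inr <| .inr <| .inr <| .inr <| .inr <| .inr <| .inr <| .inr <|
        .inl ⟨(_, _, _, _, _), h, rfl⟩
    | all_not_free =>
      exact .inr <| .inr <| .inr <| .inr <| .inr <| .inr <| .inr <| .inr <| .inr <|
        .inr ⟨(_, _, _, _), rfl⟩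

section

variable {L : Lang} {C : UnitRat → Prop}

/-- The codes of the truth constants satisfying `C`. -/
def constCodes (C : UnitRat → Prop) (n : ℕ) : Prop := ∃ r, C r ∧ r.code = n

/-- The substitution facts derivable over the language `L` with truth constants in `C`. -/
def SubstFact (L : Lang) (C : UnitRat → Prop) : Fact → Prop :=
  Derivable (SubstRule (· ∈ L.funs) (· ∈ L.rels) (constCodes C))

/-- The meaning of a fact. -/
def Fact.Holds (L : Lang) (C : UnitRat → Prop) : Fact → Prop
  | (0, x, u, _, a, b) => ∀ s : Term, s.code = u → ∃ t : Term, t.InLang L ∧ t.code = a ∧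
      (Term.subst x s t).code = b
  | (1, x, u, k, a, b) => ∀ s : Term, s.code = u → ∃ ts : Fin k → Term, (∀ j, (ts j).InLang L) ∧
      Encodable.encode (List.ofFn fun j => (ts j).code) = a ∧
      Encodable.encode (List.ofFn fun j => (Term.subst x s (ts j)).code) = b
  | (2, x, u, _, a, b) => ∀ s : Term, s.code = u → ∃ φ : Formula, φ.InLang L ∧ φ.ConstsIn C ∧
      φ.FreeFor x s ∧ φ.code = a ∧ (φ.subst x s).code = b
  | _ => True

/-- Soundness of the rules. The meaning of a fact is vacuous when `u` codes no term, which is why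
the rules may leave `u` unchecked. -/
theorem SubstFact.holds {z : Fact} (h : SubstFact L C z) : Fact.Holds L C z := by
  induction h with
  | @intro ps a hr _ ih =>
    cases hr with
    | @var_ne x u y h => exact fun s hs => ⟨.var y, trivial, rfl, by rw [Term.subst, if_neg h]; rfl⟩
    | @var_eq x u => exact fun s hs => ⟨.var x, trivial, rfl, by rw [Term.subst, if_pos rfl, hs]⟩
    | @app x u k i l l' h =>
      intro s hs
      obtain ⟨ts, h1, rfl, rfl⟩ := ih (listFact x u k l l') (by simp) s hs
      exact ⟨.app k i ts, ⟨h, h1⟩, rfl, rfl⟩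
    | @nil x u => exact fun s hs => ⟨Fin.elim0, fun j => j.elim0, rfl, rfl⟩
    | @cons x u k t t' l l' =>
      intro s hs
      obtain ⟨t, h1, rfl, rfl⟩ := ih (termFact x u t t') (by simp) s hs
      obtain ⟨ts, h2, rfl, rfl⟩ := ih (listFact x u k l l') (by simp) s hs
      refine ⟨Fin.cons t ts, Fin.cases h1 h2, ?_, ?_⟩ <;>
      simp [List.ofFn_succ, Code.cons]
    | @const x u r h =>
      obtain ⟨r, h, rfl⟩ := h
      exact fun s hs => ⟨.const r, trivial, h, trivial, rfl, rfl⟩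
    | @rel x u k i l l' h =>
      intro s hs
      obtain ⟨ts, h1, rfl, rfl⟩ := ih (listFact x u k l l') (by simp) s hs
      exact ⟨.rel k i ts, ⟨h, h1⟩, trivial, trivial, rfl, rfl⟩
    | @imp x u f f' g g' =>
      intro s hs
      obtain ⟨φ, h1, h2, h3, rfl, rfl⟩ := ih (formulaFact x u f f') (by simp) s hs
      obtain ⟨ψ, h4, h5, h6, rfl, rfl⟩ := ih (formulaFact x u g g') (by simp) s hs
      exact ⟨.imp φ ψ, ⟨h1, h4⟩, ⟨h2, h5⟩, ⟨h3, h6⟩, rfl, rfl⟩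
    | @all_self x u f =>
      intro s hs
      obtain ⟨φ, h1, h2, h3, rfl, -⟩ := ih (formulaFact 0 (var 0) f f) (by simp) (.var 0) rfl
      exact ⟨.all x φ, h1, h2, .inl fun h => h.1 rfl, rfl, by rw [Formula.subst, if_pos rfl]; rfl⟩
    | @all_not_occurs x u y f f' h =>
      intro s hs
      obtain ⟨t, -, h1, h2⟩ := ih (termFact y (var (y + 1)) u u) (by simp) (.var (y + 1)) rfl
      obtain ⟨φ, h3, h4, h5, rfl, rfl⟩ := ih (formulaFact x u f f') (by simp) s hs
      -- The term found by the first premise is `s` itself, and it is unchanged by `y ↦ y + 1`, so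
      -- `y` does not occur in it.
      have hts := Term.code_injective (h1.trans hs.symm)
      subst hts
      have := Term.not_occurs_of_subst_succ (Term.code_injective (h2.trans hs.symm))
      exact ⟨.all y φ, h3, h4, .inr ⟨this, h5⟩, rfl, by rw [Formula.subst, if_neg h]; rfl⟩
    | @all_not_free x u y f =>
      intro s hs
      obtain ⟨φ, h1, h2, h3, rfl, h4⟩ :=
        ih (formulaFact x (var (x + 1)) f f) (by simp) (.var (x + 1)) rfl
      have hf : ¬ (Formula.all y φ).Free x := fun h =>
        Formula.not_free_of_subst_succ (Formula.code_injective h4) h.2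
      exact ⟨.all y φ, h1, h2, .inl hf, rfl, by rw [Formula.subst_of_not_free _ hf]; rfl⟩

theorem substFact_term {t : Term} (ht : t.InLang L) (x : ℕ) (s : Term) :
    SubstFact L C (termFact x s.code t.code (Term.subst x s t).code) := by
  induction t with
  | var y =>
    by_cases h : y = x
    · subst h
      rw [Term.subst, if_pos rfl]
      exact .intro .var_eq (by simp)
    · rw [Term.subst, if_neg h]
      exact .intro (.var_ne h) (by simp)
  | app k i ts ih =>
    refine .intro (.app (l := Encodable.encode (List.ofFn fun j => (ts j).code)) ht.1) ?_
    simp only [List.mem_singleton, forall_eq]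
    replace ih := fun j => ih j (ht.2 j)
    clear ht
    induction k with
    | zero => exact .intro .nil (by simp)
    | succ k ihk =>
      simp only [List.ofFn_succ, Encodable.encode_list_cons]
      refine .intro .cons ?_
      simp only [List.mem_cons, List.not_mem_nil, or_false, forall_eq_or_imp, forall_eq]
      exact ⟨ih 0, ihk (fun j => ts j.succ) fun j => ih j.succ⟩

theorem substFact_list {k : ℕ} {ts : Fin k → Term} (ht : ∀ j, (ts j).InLang L) (x : ℕ) (s : Term) :
    SubstFact L C (listFact x s.code k (Encodable.encode (List.ofFn fun j => (ts j).code))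
      (Encodable.encode (List.ofFn fun j => (Term.subst x s (ts j)).code))) := by
  induction k with
  | zero => exact .intro .nil (by simp)
  | succ k ih =>
    simp only [List.ofFn_succ, Encodable.encode_list_cons]
    refine .intro .cons ?_
    simp only [List.mem_cons, List.not_mem_nil, or_false, forall_eq_or_imp, forall_eq]
    exact ⟨substFact_term (ht 0) x s, ih fun j => ht j.succ⟩

/-- Completeness of the rules. Under a quantifier, the rule to use depends on whether the bound
variable is `x` and, if not, on whether `x` is free in the body. -/
theorem substFact_formula {φ : Formula} (hL : φ.InLang L) (hC : φ.ConstsIn C) {x : ℕ} {s : Term}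
    (hs : s.InLang L) (hx : φ.FreeFor x s) :
    SubstFact L C (formulaFact x s.code φ.code (φ.subst x s).code) := by
  induction φ generalizing x s with
  | const r => exact .intro (.const ⟨r, hC, rfl⟩) (by simp)
  | rel k i ts =>
    refine .intro (.rel (l := Encodable.encode (List.ofFn fun j => (ts j).code)) hL.1) ?_
    simpa using! substFact_list hL.2 x s
  | imp φ ψ ih₁ ih₂ =>
    refine .intro .imp ?_
    simp only [List.mem_cons, List.not_mem_nil, or_false, forall_eq_or_imp, forall_eq]
    exact ⟨ih₁ hL.1 hC.1 hs hx.1, ih₂ hL.2 hC.2 hs hx.2⟩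
  | all y φ ih =>
    by_cases h : y = x
    · subst h
      rw [Formula.subst, if_pos rfl]
      refine .intro .all_self ?_
      have := ih hL hC (x := 0) (s := .var 0) trivial (Formula.freeFor_var_self 0 φ)
      rw [Formula.subst_var_self] at this
      simpa using! this
    · by_cases hf : φ.Free x
      · obtain ⟨ho, hx⟩ := hx.resolve_left fun h' => h' ⟨Ne.symm h, hf⟩
        rw [Formula.subst, if_neg h]
        refine .intro (.all_not_occurs h) ?_
        simp only [List.mem_cons, List.not_mem_nil, or_false, forall_eq_or_imp, forall_eq]
        have := substFact_term (C := C) hs y (.var (y + 1))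
        rw [Term.subst_of_not_occurs _ ho] at this
        exact ⟨this, ih hL hC hs hx⟩
      · rw [Formula.subst, if_neg h, Formula.subst_of_not_free _ hf]
        refine .intro .all_not_free ?_
        have := ih hL hC (s := .var (x + 1)) trivial (Formula.freeFor_of_not_free _ hf)
        rw [Formula.subst_of_not_free _ hf] at this
        simpa using! this

theorem rePred_substFact (hF : REPred (· ∈ L.funs)) (hR : REPred (· ∈ L.rels))
    (hC : REPred (constCodes C)) : REPred (SubstFact L C) :=
  (rePred_substRule hF hR hC).derivable

/-- The codes of the formulas of `L` with truth constants in `C`. -/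
def IsFormula (L : Lang) (C : UnitRat → Prop) (f : ℕ) : Prop :=
  ∃ φ : Formula, φ.InLang L ∧ φ.ConstsIn C ∧ φ.code = f

theorem rePred_isFormula (h : REPred (SubstFact L C)) : REPred (IsFormula L C) := by
  refine (h.comp (f := fun f => formulaFact 0 (var 0) f f) (Primrec.to_comp
    (by unfold formulaFact var; fun_prop))).of_eq fun f => ⟨fun hf => ?_, ?_⟩
  · obtain ⟨φ, h1, h2, -, h3, -⟩ := hf.holds (.var 0) rfl
    exact ⟨φ, h1, h2, h3⟩
  · rintro ⟨φ, h1, h2, rfl⟩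
    have := substFact_formula h1 h2 (x := 0) (s := .var 0) trivial (Formula.freeFor_var_self 0 φ)
    rwa [Formula.subst_var_self] at this

/-- The pairs of a variable and the code of a formula in which it is not free. -/
def IsNotFree (L : Lang) (C : UnitRat → Prop) (z : ℕ × ℕ) : Prop :=
  ∃ φ : Formula, φ.InLang L ∧ φ.ConstsIn C ∧ ¬ φ.Free z.1 ∧ φ.code = z.2

theorem rePred_isNotFree (h : REPred (SubstFact L C)) : REPred (IsNotFree L C) := by
  refine (h.comp (f := fun z : ℕ × ℕ => formulaFact z.1 (var (z.1 + 1)) z.2 z.2) (Primrec.to_comp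
    (by unfold formulaFact var; fun_prop))).of_eq fun z => ⟨fun hz => ?_, ?_⟩
  · obtain ⟨φ, h1, h2, -, h3, h4⟩ := hz.holds (.var (z.1 + 1)) rfl
    exact ⟨φ, h1, h2, Formula.not_free_of_subst_succ (Formula.code_injective (h4.trans h3.symm)),
      h3⟩
  · rcases z with ⟨x, f⟩
    rintro ⟨φ, h1, h2, h3, rfl⟩
    have := substFact_formula h1 h2 (s := .var (x + 1)) trivial (Formula.freeFor_of_not_free _ h3)
    rwa [Formula.subst_of_not_free _ h3] at this

/-- The codes `(x, t, f, f')` of admissible substitutions. -/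
def IsSubst (L : Lang) (C : UnitRat → Prop) (z : ℕ × ℕ × ℕ × ℕ) : Prop :=
  ∃ (φ : Formula) (t : Term), φ.InLang L ∧ φ.ConstsIn C ∧ t.InLang L ∧ φ.FreeFor z.1 t ∧
    t.code = z.2.1 ∧ φ.code = z.2.2.1 ∧ (φ.subst z.1 t).code = z.2.2.2

/-- The formula fact does not guarantee that `z.2.1` codes a term of `L`; the added identity
substitution on that code does. -/
theorem rePred_isSubst (h : REPred (SubstFact L C)) : REPred (IsSubst L C) := by
  refine ((h.comp (f := fun z : ℕ × ℕ × ℕ × ℕ => formulaFact z.1 z.2.1 z.2.2.1 z.2.2.2)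
    (Primrec.to_comp (by unfold formulaFact; fun_prop))).and
    (h.comp (f := fun z : ℕ × ℕ × ℕ × ℕ => termFact 0 (var 0) z.2.1 z.2.1)
    (Primrec.to_comp (by unfold termFact var; fun_prop)))).of_eq fun z => ⟨?_, ?_⟩
  · rintro ⟨hf, ht⟩
    obtain ⟨t, h1, h2, -⟩ := ht.holds (.var 0) rfl
    obtain ⟨φ, h3, h4, h5, h6, h7⟩ := hf.holds t h2
    exact ⟨φ, t, h3, h4, h1, h5, h2, h6, h7⟩
  · rcases z with ⟨x, u, f, f'⟩
    rintro ⟨φ, t, h1, h2, h3, h4, h5, h6, h7⟩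
    dsimp only at h4 h5 h6 h7
    subst h5 h6 h7
    have := substFact_term (C := C) h3 0 (.var 0)
    rw [Term.subst_var_self] at this
    exact ⟨substFact_formula h1 h2 h3 h4, this⟩

end

end Code

end RPL

/-! ### Codes of truth constants and their truncated subtraction. -/

/-- Bézout's identity with the negative term moved across. It makes being a reduced fraction an
existential condition on an equation in ℕ, hence r.e. -/
theorem Nat.coprime_iff_exists_mul {a b : ℕ} (hb : b ≠ 0) :
    Nat.Coprime a b ↔ ∃ c d, a * c = 1 + b * d ∨ b * c = 1 + a * d := by
  constructor
  · intro h
    rcases (Nat.one_le_iff_ne_zero.2 hb).eq_or_lt with rfl | hb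
    · exact ⟨1, 0, .inr rfl⟩
    · obtain ⟨m, hm⟩ := Nat.exists_mul_mod_eq_one_of_coprime h hb
      refine ⟨m, a * m / b, .inl ?_⟩
      have := Nat.mod_add_div (a * m) b
      omega
  · rintro ⟨c, d, h | h⟩
    · have h1 : a.gcd b ∣ 1 + b * d := h ▸ (Nat.gcd_dvd_left a b).mul_right c
      exact Nat.dvd_one.1 ((Nat.dvd_add_iff_left ((Nat.gcd_dvd_right a b).mul_right d)).2 h1)
    · have h1 : a.gcd b ∣ 1 + a * d := h ▸ (Nat.gcd_dvd_right a b).mul_right c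
      exact Nat.dvd_one.1 ((Nat.dvd_add_iff_left ((Nat.gcd_dvd_left a b).mul_right d)).2 h1)

namespace RPL

theorem UnitRat.val_eq_div (r : UnitRat) :
    r.1 = (r.code.unpair.1 : ℚ) / (r.code.unpair.2 : ℚ) := by
  have h : ((r.1.num.toNat : ℤ) : ℚ) = (r.1.num : ℚ) := by
    rw [Int.toNat_of_nonneg (Rat.num_nonneg.2 r.2.1)]
  simp only [UnitRat.code, Nat.unpair_pair]
  rw [← Int.cast_natCast, h, Rat.num_div_den]

theorem UnitRat.code_unpair_ne_zero (r : UnitRat) : r.code.unpair.2 ≠ 0 := by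
  simp [UnitRat.code]

theorem UnitRat.exists_code_eq_iff (n : ℕ) : (∃ r : UnitRat, r.code = n) ↔
    n.unpair.2 ≠ 0 ∧ n.unpair.1 ≤ n.unpair.2 ∧ Nat.Coprime n.unpair.1 n.unpair.2 := by
  constructor
  · rintro ⟨r, rfl⟩
    refine ⟨r.code_unpair_ne_zero, ?_, ?_⟩
    · have h := r.2.2
      rw [UnitRat.val_eq_div, div_le_one (by have := r.code_unpair_ne_zero; positivity)] at h
      exact_mod_cast h
    · have := r.1.reduced
      rw [← Int.toNat_of_nonneg (Rat.num_nonneg.2 r.2.1), Int.natAbs_natCast] at this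
      simpa [UnitRat.code] using this
  · rintro ⟨h1, h2, h3⟩
    have h : (⟨(n.unpair.1 : ℤ), n.unpair.2, h1, by simpa using h3⟩ : ℚ) =
        (n.unpair.1 : ℚ) / (n.unpair.2 : ℚ) := by
      rw [← Rat.num_div_den (⟨_, _, h1, _⟩ : ℚ)]
      simp
    refine ⟨⟨⟨(n.unpair.1 : ℤ), n.unpair.2, h1, by simpa using h3⟩, ?_, ?_⟩, ?_⟩
    · rw [h]; positivity
    · rw [h]
      exact div_le_one_of_le₀ (by exact_mod_cast h2) (by positivity)
    · simp [UnitRat.code]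

/-- Cross-multiplication; subtraction in ℕ truncates exactly as the maximum with 0 does. -/
theorem UnitRat.eq_tsub_iff (r s q : UnitRat) : q = UnitRat.tsub s r ↔
    q.code.unpair.1 * (s.code.unpair.2 * r.code.unpair.2) =
      (s.code.unpair.1 * r.code.unpair.2 - r.code.unpair.1 * s.code.unpair.2) *
        q.code.unpair.2 := by
  rw [Subtype.ext_iff]
  simp only [UnitRat.tsub]
  rw [q.val_eq_div, r.val_eq_div, s.val_eq_div]
  have hq := q.code_unpair_ne_zero
  have hr := r.code_unpair_ne_zero
  have hs := s.code_unpair_ne_zero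
  generalize q.code.unpair = q at *
  generalize r.code.unpair = r at *
  generalize s.code.unpair = s at *
  have hq' : (0 : ℚ) < q.2 := by positivity
  have hr' : (0 : ℚ) < r.2 := by positivity
  have hs' : (0 : ℚ) < s.2 := by positivity
  have h : max ((s.1 : ℚ) / s.2 - r.1 / r.2) 0 =
      ((s.1 * r.2 - r.1 * s.2 : ℕ) : ℚ) / (s.2 * r.2) := by
    rw [div_sub_div _ _ hs'.ne' hr'.ne']
    rcases le_total (r.1 * s.2) (s.1 * r.2) with hle | hle
    · rw [Nat.cast_sub hle, max_eq_left]
      · push_cast; ring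
      · have : ((r.1 * s.2 : ℕ) : ℚ) ≤ (s.1 * r.2 : ℕ) := by exact_mod_cast hle
        push_cast at this
        exact div_nonneg (by linarith) (by positivity)
    · rw [Nat.sub_eq_zero_of_le hle, max_eq_right]
      · simp
      · have : ((s.1 * r.2 : ℕ) : ℚ) ≤ (r.1 * s.2 : ℕ) := by exact_mod_cast hle
        push_cast at this
        exact div_nonpos_of_nonpos_of_nonneg (by linarith) (by positivity)
  rw [h, div_eq_div_iff hq'.ne' (by positivity)]
  exact_mod_cast Iff.rfl

namespace Code

theorem rePred_constCodes_true : REPred (constCodes fun _ => True) := by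
  have h : PrimrecPred fun z : ℕ × ℕ × ℕ => z.1.unpair.2 ≠ 0 ∧ z.1.unpair.1 ≤ z.1.unpair.2 ∧
      (z.1.unpair.1 * z.2.1 = 1 + z.1.unpair.2 * z.2.2 ∨
        z.1.unpair.2 * z.2.1 = 1 + z.1.unpair.1 * z.2.2) := by
    refine .and (.not (Primrec.eq.comp ?_ ?_)) (.and (Primrec.nat_le.comp ?_ ?_)
      (.or (Primrec.eq.comp ?_ ?_) (Primrec.eq.comp ?_ ?_))) <;> fun_prop
  refine h.computablePred.to_re.exists_snd.of_eq fun n => ?_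
  simp only [constCodes, true_and, UnitRat.exists_code_eq_iff, Prod.exists]
  constructor
  · rintro ⟨c, d, h1, h2, h3⟩
    exact ⟨h1, h2, (Nat.coprime_iff_exists_mul h1).2 ⟨c, d, h3⟩⟩
  · rintro ⟨h1, h2, h3⟩
    obtain ⟨c, d, h⟩ := (Nat.coprime_iff_exists_mul h1).1 h3
    exact ⟨c, d, h1, h2, h⟩

theorem rePred_tsub : REPred fun z : ℕ × ℕ × ℕ =>
    ∃ r s : UnitRat, r.code = z.1 ∧ s.code = z.2.1 ∧ (UnitRat.tsub s r).code = z.2.2 := by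
  have h : PrimrecPred fun z : ℕ × ℕ × ℕ =>
      z.2.2.unpair.1 * (z.2.1.unpair.2 * z.1.unpair.2) =
      (z.2.1.unpair.1 * z.1.unpair.2 - z.1.unpair.1 * z.2.1.unpair.2) * z.2.2.unpair.2 := by
    refine Primrec.eq.comp ?_ ?_ <;> fun_prop
  have hC := rePred_constCodes_true
  refine ((hC.comp Computable.fst).and <| (hC.comp (Computable.fst.comp Computable.snd)).and <|
    (hC.comp (Computable.snd.comp Computable.snd)).and h.computablePred.to_re).of_eq
    fun z => ⟨?_, ?_⟩
  · rcases z with ⟨_, _, _⟩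
    rintro ⟨⟨r, -, rfl⟩, ⟨s, -, rfl⟩, ⟨q, -, rfl⟩, h⟩
    exact ⟨r, s, rfl, rfl, by rw [(UnitRat.eq_tsub_iff r s q).2 h]⟩
  · rcases z with ⟨_, _, _⟩
    rintro ⟨r, s, rfl, rfl, rfl⟩
    exact ⟨⟨r, trivial, rfl⟩, ⟨s, trivial, rfl⟩, ⟨_, trivial, rfl⟩,
      (UnitRat.eq_tsub_iff r s _).1 rfl⟩

/-! ### Arithmetization of proofs. -/

def neg (f : ℕ) : ℕ := imp f Formula.bot.code

def iff (f g : ℕ) : ℕ := neg (imp (imp f g) (neg (imp g f)))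

open Formula in
/-- The rules of proof in the theory `T`, as rules on codes of formulas. -/
inductive ProofRule (T : Theory) : List ℕ × ℕ → Prop
  | hyp {φ : Formula} : φ ∈ T.axioms → ProofRule T ([], φ.code)
  | ax1 {φ ψ : Formula} : φ.InLang T.lang → ψ.InLang T.lang →
      ProofRule T ([], (Formula.imp φ (.imp ψ φ)).code)
  | ax2 {φ ψ σ : Formula} : φ.InLang T.lang → ψ.InLang T.lang → σ.InLang T.lang →
      ProofRule T ([], (Formula.imp (.imp φ ψ) (.imp (.imp ψ σ) (.imp φ σ))).code)
  | ax3 {φ ψ : Formula} : φ.InLang T.lang → ψ.InLang T.lang →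
      ProofRule T ([], (Formula.imp (.imp (.imp φ ψ) ψ) (.imp (.imp ψ φ) φ)).code)
  | ax4 {φ ψ : Formula} : φ.InLang T.lang → ψ.InLang T.lang →
      ProofRule T ([], (Formula.imp (.imp (.imp φ bot) (.imp ψ bot)) (.imp ψ φ)).code)
  | all1 {φ : Formula} {x : ℕ} {t : Term} : φ.InLang T.lang → t.InLang T.lang → φ.FreeFor x t →
      ProofRule T ([], (Formula.imp (.all x φ) (φ.subst x t)).code)
  | all2 {φ ψ : Formula} {x : ℕ} : φ.InLang T.lang → ψ.InLang T.lang → ¬ φ.Free x →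
      ProofRule T ([], (Formula.imp (.all x (.imp φ ψ)) (.imp φ (.all x ψ))).code)
  | axR (r s : UnitRat) : ProofRule T
      ([], (Formula.iff (.imp (.const r) (.const s)) (.const (UnitRat.tsub s r))).code)
  | mp {f g : ℕ} : ProofRule T ([f, imp f g], g)
  | gen {x f : ℕ} : ProofRule T ([f], all x f)

/-- Modus ponens and generalization act on arbitrary numbers, which is harmless because derivable
premises are already codes of theorems. -/
theorem derivable_proofRule_iff (T : Theory) (f : ℕ) :
    Derivable (ProofRule T) f ↔ ∃ φ, T.Proves φ ∧ φ.code = f := by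
  constructor
  · intro h
    induction h with
    | @intro ps f hr _ ih =>
      cases hr with
      | hyp h => exact ⟨_, .hyp h (T.inLang _ h), rfl⟩
      | ax1 h1 h2 => exact ⟨_, .ax1 h1 h2, rfl⟩
      | ax2 h1 h2 h3 => exact ⟨_, .ax2 h1 h2 h3, rfl⟩
      | ax3 h1 h2 => exact ⟨_, .ax3 h1 h2, rfl⟩
      | ax4 h1 h2 => exact ⟨_, .ax4 h1 h2, rfl⟩
      | all1 h1 h2 h3 => exact ⟨_, .all1 h1 h2 h3, rfl⟩
      | all2 h1 h2 h3 => exact ⟨_, .all2 h1 h2 h3, rfl⟩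
      | axR r s => exact ⟨_, .axR r s, rfl⟩
      | @mp e _ =>
        obtain ⟨φ, hφ, rfl⟩ := ih e (by simp)
        obtain ⟨χ, hχ, h⟩ := ih (imp φ.code f) (by simp)
        -- The tag 2 forces the major premise to be an implication; injectivity then matches its
        -- antecedent with the minor premise.
        cases χ <;> simp [Formula.code, imp] at h
        obtain ⟨h, rfl⟩ := h
        cases Formula.code_injective h
        exact ⟨_, .mp hφ hχ, rfl⟩
      | @gen x f =>
        obtain ⟨φ, hφ, rfl⟩ := ih f (by simp)
        exact ⟨_, .gen x hφ, rfl⟩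
  · rintro ⟨φ, h, rfl⟩
    induction h with
    | hyp h _ => exact .intro (.hyp h) (by simp)
    | ax1 h1 h2 => exact .intro (.ax1 h1 h2) (by simp)
    | ax2 h1 h2 h3 => exact .intro (.ax2 h1 h2 h3) (by simp)
    | ax3 h1 h2 => exact .intro (.ax3 h1 h2) (by simp)
    | ax4 h1 h2 => exact .intro (.ax4 h1 h2) (by simp)
    | all1 h1 h2 h3 => exact .intro (.all1 h1 h2 h3) (by simp)
    | all2 h1 h2 h3 => exact .intro (.all2 h1 h2 h3) (by simp)
    | axR r s => exact .intro (.axR r s) (by simp)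
    | @mp φ ψ _ _ ih1 ih2 =>
      refine .intro (.mp (f := φ.code)) ?_
      simp only [List.mem_cons, List.not_mem_nil, or_false, forall_eq_or_imp, forall_eq]
      exact ⟨ih1, ih2⟩
    | @gen φ x _ ih => exact .intro .gen (by simpa using ih)

theorem rePred_proofRule {T : Theory} (hT : T.ComputablyAxiomatizable) : REPred (ProofRule T) := by
  have hS := rePred_substFact (L := T.lang) hT.1.1.to_re hT.1.2.to_re rePred_constCodes_true
  have hF : REPred fun f => ∃ φ : Formula, φ.InLang T.lang ∧ φ.code = f :=
    (rePred_isFormula hS).of_eq fun f => by simp [IsFormula, Formula.constsIn_true]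
  have hF2 := (hF.comp (Computable.fst (α := ℕ) (β := ℕ))).and (hF.comp Computable.snd)
  have hF3 := (hF.comp (Computable.fst (α := ℕ) (β := ℕ × ℕ))).and (hF2.comp Computable.snd)
  have hN := ((rePred_isNotFree hS).comp (f := fun a : ℕ × ℕ × ℕ => (a.1, a.2.1))
    (Primrec.to_comp (by fun_prop))).and (hF.comp (f := fun a : ℕ × ℕ × ℕ => a.2.2)
    (Primrec.to_comp (by fun_prop)))
  have h0 := hT.2.image (f := fun f => (([] : List ℕ), f)) (by fun_prop)
  have h1 := hF2.image (f := fun a => (([] : List ℕ), imp a.1 (imp a.2 a.1)))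
    (by unfold imp; fun_prop)
  have h2 := hF3.image (f := fun a => (([] : List ℕ),
    imp (imp a.1 a.2.1) (imp (imp a.2.1 a.2.2) (imp a.1 a.2.2)))) (by unfold imp; fun_prop)
  have h3 := hF2.image (f := fun a => (([] : List ℕ),
    imp (imp (imp a.1 a.2) a.2) (imp (imp a.2 a.1) a.1))) (by unfold imp; fun_prop)
  have h4 := hF2.image (f := fun a => (([] : List ℕ),
    imp (imp (neg a.1) (neg a.2)) (imp a.2 a.1))) (by unfold neg imp; fun_prop)
  have h5 := (rePred_isSubst hS).image (f := fun a => (([] : List ℕ),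
    imp (all a.1 a.2.2.1) a.2.2.2)) (by unfold imp all; fun_prop)
  have h6 := hN.image (f := fun a => (([] : List ℕ),
    imp (all a.1 (imp a.2.1 a.2.2)) (imp a.2.1 (all a.1 a.2.2)))) (by unfold imp all; fun_prop)
  have h7 := rePred_tsub.image (f := fun a => (([] : List ℕ),
    iff (imp (const a.1) (const a.2.1)) (const a.2.2))) (by unfold iff neg imp const; fun_prop)
  have h8 := REPred.range (f := fun a : ℕ × ℕ => ([a.1, imp a.1 a.2], a.2))
    (by unfold imp; fun_prop)
  have h9 := REPred.range (f := fun a : ℕ × ℕ => ([a.2], all a.1 a.2)) (by unfold all; fun_prop)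
  refine (h0.or <| h1.or <| h2.or <| h3.or <| h4.or <| h5.or <| h6.or <| h7.or <|
    h8.or h9).of_eq fun z => ⟨?_, fun h => ?_⟩
  · rintro (⟨_, ⟨φ, h, rfl⟩, rfl⟩ | ⟨⟨_, _⟩, ⟨⟨φ, hφ, rfl⟩, ψ, hψ, rfl⟩, rfl⟩ |
      ⟨⟨_, _, _⟩, ⟨⟨φ, hφ, rfl⟩, ⟨ψ, hψ, rfl⟩, σ, hσ, rfl⟩, rfl⟩ |
      ⟨⟨_, _⟩, ⟨⟨φ, hφ, rfl⟩, ψ, hψ, rfl⟩, rfl⟩ | ⟨⟨_, _⟩, ⟨⟨φ, hφ, rfl⟩, ψ, hψ, rfl⟩, rfl⟩ |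
      ⟨⟨x, u, f, f'⟩, ⟨φ, t, hφ, -, ht, hx, h1, h2, h3⟩, rfl⟩ |
      ⟨⟨x, _, _⟩, ⟨⟨φ, hφ, -, hx, rfl⟩, ψ, hψ, rfl⟩, rfl⟩ |
      ⟨⟨_, _, _⟩, ⟨r, s, rfl, rfl, rfl⟩, rfl⟩ | ⟨a, rfl⟩ | ⟨a, rfl⟩)
    · exact .hyp h
    · exact .ax1 hφ hψ
    · exact .ax2 hφ hψ hσ
    · exact .ax3 hφ hψ
    · exact .ax4 hφ hψ
    · dsimp only at hx h1 h2 h3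
      subst h1 h2 h3
      exact .all1 hφ ht hx
    · exact .all2 hφ hψ hx
    · exact .axR r s
    · exact .mp
    · exact .gen
  · cases h with
    | hyp h => exact .inl ⟨_, ⟨_, h, rfl⟩, rfl⟩
    | ax1 h1 h2 => exact .inr <| .inl ⟨(_, _), ⟨⟨_, h1, rfl⟩, _, h2, rfl⟩, rfl⟩
    | ax2 h1 h2 h3 =>
      exact .inr <| .inr <| .inl ⟨(_, _, _), ⟨⟨_, h1, rfl⟩, ⟨_, h2, rfl⟩, _, h3, rfl⟩, rfl⟩
    | ax3 h1 h2 =>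
      exact .inr <| .inr <| .inr <| .inl ⟨(_, _), ⟨⟨_, h1, rfl⟩, _, h2, rfl⟩, rfl⟩
    | ax4 h1 h2 =>
      exact .inr <| .inr <| .inr <| .inr <| .inl ⟨(_, _), ⟨⟨_, h1, rfl⟩, _, h2, rfl⟩, rfl⟩
    | all1 h1 h2 h3 =>
      exact .inr <| .inr <| .inr <| .inr <| .inr <| .inl
        ⟨(_, _, _, _), ⟨_, _, h1, Formula.constsIn_true _, h2, h3, rfl, rfl, rfl⟩, rfl⟩
    | all2 h1 h2 h3 =>
      exact .inr <| .inr <| .inr <| .inr <| .inr <| .inr <| .inl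
        ⟨(_, _, _), ⟨⟨_, h1, Formula.constsIn_true _, h3, rfl⟩, _, h2, rfl⟩, rfl⟩
    | axR r s =>
      exact .inr <| .inr <| .inr <| .inr <| .inr <| .inr <| .inr <| .inl
        ⟨(_, _, _), ⟨r, s, rfl, rfl, rfl⟩, rfl⟩
    | mp =>
      exact .inr <| .inr <| .inr <| .inr <| .inr <| .inr <| .inr <| .inr <| .inl ⟨(_, _), rfl⟩
    | gen =>
      exact .inr <| .inr <| .inr <| .inr <| .inr <| .inr <| .inr <| .inr <| .inr ⟨(_, _), rfl⟩

end Code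

/-- The theorems of a computably axiomatizable theory are computably enumerable. -/
theorem Theory.ComputablyAxiomatizable.rePred_proves {T : Theory}
    (hT : T.ComputablyAxiomatizable) : REPred fun n => ∃ φ, T.Proves φ ∧ φ.code = n :=
  (Code.rePred_proofRule hT).derivable.of_eq (Code.derivable_proofRule_iff T)

end RPL

namespace RPL

/-! ### Soundness -/

section

variable {M : Type u} (S : Interp M)

theorem Formula.eval_mem_Icc [Nonempty M] (φ : Formula) (v : ℕ → M) :
    φ.eval S v ∈ Set.Icc (0 : ℝ) 1 := by
  induction φ generalizing v with
  | const r =>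
    have h : (0 : ℝ) ≤ (r.1 : ℝ) ∧ (r.1 : ℝ) ≤ 1 := by exact_mod_cast r.2
    exact h
  | rel k i ts => exact (S.rel k i _).2
  | imp φ ψ ih₁ ih₂ =>
    exact ⟨le_max_right _ _, max_le (by linarith [(ih₁ v).1, (ih₂ v).2]) zero_le_one⟩
  | all x φ ih =>
    exact ⟨Real.iSup_nonneg fun a => (ih _).1, ciSup_le fun a => (ih _).2⟩

/-- Needed because the real supremum of an unbounded family is the default value 0, so `le_ciSup`
asks for a bound. -/
theorem Formula.bddAbove_range_eval [Nonempty M] (φ : Formula) (v : ℕ → M) (x : ℕ) :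
    BddAbove (Set.range fun a : M => φ.eval S (Function.update v x a)) :=
  ⟨1, by rintro _ ⟨a, rfl⟩; exact (φ.eval_mem_Icc S _).2⟩

theorem Term.eval_congr {t : Term} {v w : ℕ → M} (h : ∀ x, t.Occurs x → v x = w x) :
    t.eval S v = t.eval S w := by
  induction t with
  | var x => exact h x rfl
  | app k i ts ih =>
    exact congrArg (S.fn k i) (funext fun j => ih j fun x hx => h x ⟨j, hx⟩)

theorem Formula.eval_congr {φ : Formula} {v w : ℕ → M} (h : ∀ x, φ.Free x → v x = w x) :
    φ.eval S v = φ.eval S w := by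
  induction φ generalizing v w with
  | const r => rfl
  | rel k i ts =>
    exact congrArg (fun a => (S.rel k i a : ℝ))
      (funext fun j => Term.eval_congr S fun x hx => h x ⟨j, hx⟩)
  | imp φ ψ ih₁ ih₂ =>
    simp only [eval, ih₁ fun x hx => h x (.inl hx), ih₂ fun x hx => h x (.inr hx)]
  | all y φ ih =>
    refine congrArg iSup (funext fun a => ih fun x hx => ?_)
    by_cases hxy : x = y
    · simp [hxy]
    · simp [hxy, h x ⟨hxy, hx⟩]

theorem Term.eval_subst (x : ℕ) (s t : Term) (v : ℕ → M) :
    (Term.subst x s t).eval S v = t.eval S (Function.update v x (s.eval S v)) := by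
  induction t with
  | var y =>
    by_cases h : y = x
    · subst h; simp [subst, eval]
    · simp [subst, eval, h]
  | app k i ts ih => exact congrArg (S.fn k i) (funext fun j => ih j)

theorem Formula.eval_subst {x : ℕ} {s : Term} {φ : Formula} (h : φ.FreeFor x s) (v : ℕ → M) :
    (φ.subst x s).eval S v = φ.eval S (Function.update v x (s.eval S v)) := by
  induction φ generalizing v with
  | const r => rfl
  | rel k i ts =>
    exact congrArg (fun a => (S.rel k i a : ℝ)) (funext fun j => Term.eval_subst S x s (ts j) v)
  | imp φ ψ ih₁ ih₂ => simp only [subst, eval, ih₁ h.1, ih₂ h.2]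
  | all y φ ih =>
    by_cases hf : (all y φ).Free x
    · obtain ⟨ho, hs⟩ := h.resolve_left fun h' => h' hf
      have hne : y ≠ x := fun e => hf.1 e.symm
      rw [subst, if_neg hne]
      refine congrArg iSup (funext fun a => ?_)
      -- No capture: `y` does not occur in `s`, so the two updates can be exchanged.
      have hv : s.eval S (Function.update v y a) = s.eval S v :=
        Term.eval_congr S fun z hz => Function.update_of_ne (by rintro rfl; exact ho hz) _ _
      rw [ih hs, Function.update_comm hne, hv]
    · rw [subst_of_not_free _ hf]
      refine eval_congr S fun z hz => ?_
      rw [Function.update_of_ne]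
      rintro rfl
      exact hf hz

/-- Soundness: if all axioms are true under all evaluations, then so are all theorems. -/
theorem Provable.eval_eq_zero [Nonempty M] {L : Lang} {T : Set Formula}
    (hT : ∀ φ ∈ T, ∀ v, φ.eval S v = 0) {φ : Formula} (h : Provable L T φ) (v : ℕ → M) :
    φ.eval S v = 0 := by
  have bd := fun (φ : Formula) (v : ℕ → M) => φ.eval_mem_Icc S v
  induction h generalizing v with
  | hyp h _ => exact hT _ h v
  | @ax1 φ ψ _ _ =>
    have := bd φ v; have := bd ψ v
    simp only [Formula.eval, Set.mem_Icc] at *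
    grind
  | @ax2 φ ψ σ _ _ _ =>
    simp only [Formula.eval]
    grind
  | @ax3 φ ψ _ _ =>
    have := bd φ v; have := bd ψ v
    simp only [Formula.eval, Set.mem_Icc] at *
    grind
  | @ax4 φ ψ _ _ =>
    have := bd φ v; have := bd ψ v
    simp only [Formula.eval, Formula.bot, Set.mem_Icc] at *
    push_cast
    grind
  | @all1 φ x t _ _ hf =>
    simp only [Formula.eval, Formula.eval_subst S hf]
    exact max_eq_right (sub_nonpos.2 (le_ciSup (φ.bddAbove_range_eval S v x) (t.eval S v)))
  | @all2 φ ψ x _ _ hx =>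
    have hφ : ∀ a, φ.eval S (Function.update v x a) = φ.eval S v := fun a =>
      Formula.eval_congr S fun y hy => Function.update_of_ne (by rintro rfl; exact hx hy) _ _
    have hb := (Formula.imp φ ψ).bddAbove_range_eval S v x
    have h1 : ∀ a, ψ.eval S (Function.update v x a) - φ.eval S v ≤
        ⨆ a, (Formula.imp φ ψ).eval S (Function.update v x a) := fun a => by
      refine le_trans ?_ (le_ciSup hb a)
      simp only [Formula.eval, hφ]
      exact le_max_left _ _
    -- The degree of `φ` does not depend on `a`, so it can be moved out of the supremum.
    have h2 : (⨆ a, ψ.eval S (Function.update v x a)) ≤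
        (⨆ a, (Formula.imp φ ψ).eval S (Function.update v x a)) + φ.eval S v :=
      ciSup_le fun a => by linarith [h1 a]
    have h3 := (bd (.all x (.imp φ ψ)) v).1
    change max (max ((⨆ a, ψ.eval S (Function.update v x a)) - φ.eval S v) 0 -
      ⨆ a, (Formula.imp φ ψ).eval S (Function.update v x a)) 0 = 0
    refine max_eq_right (sub_nonpos.2 (max_le ?_ h3))
    linarith
  | axR r s =>
    have h : ((UnitRat.tsub s r).1 : ℝ) = max ((s.1 : ℝ) - r.1) 0 := by
      simp [UnitRat.tsub]
    simp [Formula.iff, Formula.oplus, Formula.neg, Formula.eval, Formula.bot, h]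
  | @mp φ ψ _ _ ih1 ih2 =>
    have h1 := ih1 v
    have h2 := ih2 v
    have := bd ψ v
    simp only [Formula.eval, h1, Set.mem_Icc] at *
    grind
  | @gen φ x _ ih => simp [Formula.eval, ih]

end

/-! ### The theory -/

/-- The language with constants `c₀, c₁, …` and a unary relation symbol. -/
def constLang : Lang where
  funs := {p | p.1 = 0}
  rels := {(1, 0)}

/-- The unary relation symbol applied to the constant `cₙ`. -/
def atom (n : ℕ) : Formula := .rel 1 0 fun _ => .app 0 n Fin.elim0

theorem atom_inLang (n : ℕ) : (atom n).InLang constLang :=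
  ⟨rfl, fun _ => ⟨rfl, fun j => j.elim0⟩⟩

theorem atom_isSentence (n : ℕ) : (atom n).IsSentence := fun _ ⟨_, j, _⟩ => j.elim0

theorem atom_code (n : ℕ) : (atom n).code = Code.app 1 0 (Code.cons (Code.app 0 n 0) 0) := by
  simp [atom, Formula.code, Term.code, Code.app, Code.cons]

theorem primrec_atom_code : Primrec fun n => (atom n).code := by
  simp only [atom_code]
  unfold Code.app Code.cons
  fun_prop

/-- Excluded middle for `φ`. -/
def excludedMiddle (φ : Formula) : Formula := .or φ φ.neg

/-- The classical theory saying that the relation holds of the constants in one of two recursively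
inseparable sets and fails for those in the other. -/
def inseparableTheory : Theory where
  lang := constLang
  axioms := {φ | (∃ n, SelfOutput 0 n ∧ atom n = φ) ∨ (∃ n, SelfOutput 1 n ∧ (atom n).neg = φ) ∨
    -- The restriction is essential: for a constant `r` strictly between 0 and 1, excluded middle
    -- has degree `min r (1 - r) > 0` in every structure.
    ∃ ψ : Formula, (ψ.InLang constLang ∧ ψ.IsLukasiewicz) ∧ excludedMiddle ψ = φ}
  inLang := by
    rintro _ (⟨n, -, rfl⟩ | ⟨n, -, rfl⟩ | ⟨ψ, ⟨h, -⟩, rfl⟩)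
    · exact atom_inLang n
    · exact ⟨atom_inLang n, trivial⟩
    · exact ⟨⟨h, h, trivial⟩, h, trivial⟩

theorem constLang_computablyGiven : constLang.ComputablyGiven :=
  ⟨(Primrec.eq.comp Primrec.fst (Primrec.const 0)).computablePred,
    (Primrec.eq.comp Primrec.id (Primrec.const (1, 0))).computablePred⟩

theorem computablyAxiomatizable_inseparableTheory :
    inseparableTheory.ComputablyAxiomatizable := by
  refine ⟨constLang_computablyGiven, ?_⟩
  have hC : REPred (Code.constCodes fun r => r.1 = 1) := by
    refine (PrimrecPred.computablePred (Primrec.eq.comp Primrec.id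
      (Primrec.const (UnitRat.code ⟨1, zero_le_one, le_rfl⟩)))).to_re.of_eq fun n => ?_
    constructor
    · rintro rfl
      exact ⟨⟨1, zero_le_one, le_rfl⟩, rfl, rfl⟩
    · rintro ⟨⟨r, hr⟩, rfl, rfl⟩
      rfl
  have hF := Code.rePred_isFormula (Code.rePred_substFact constLang_computablyGiven.1.to_re
    constLang_computablyGiven.2.to_re hC)
  have h1 := (rePred_selfOutput 0).image (f := fun n => (atom n).code)
    primrec_atom_code
  have h2 := (rePred_selfOutput 1).image
    (f := fun n => Code.neg (atom n).code)
    (by have := primrec_atom_code; unfold Code.neg Code.imp; fun_prop)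
  have h3 := hF.image (f := fun f => Code.imp (Code.imp f (Code.neg f)) (Code.neg f))
    (by unfold Code.neg Code.imp; fun_prop)
  refine (h1.or (h2.or h3)).of_eq fun n => ⟨?_, ?_⟩
  · rintro (⟨n, h, rfl⟩ | ⟨n, h, rfl⟩ | ⟨_, ⟨ψ, h, h', rfl⟩, rfl⟩)
    · exact ⟨_, .inl ⟨n, h, rfl⟩, rfl⟩
    · exact ⟨_, .inr (.inl ⟨n, h, rfl⟩), rfl⟩
    · exact ⟨_, .inr (.inr ⟨ψ, ⟨h, (Formula.constsIn_one_iff ψ).1 h'⟩, rfl⟩), rfl⟩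
  · rintro ⟨_, ⟨n, h, rfl⟩ | ⟨n, h, rfl⟩ | ⟨ψ, ⟨h, h'⟩, rfl⟩, rfl⟩
    · exact .inl ⟨n, h, rfl⟩
    · exact .inr (.inl ⟨n, h, rfl⟩)
    · exact .inr (.inr ⟨_, ⟨ψ, h, (Formula.constsIn_one_iff ψ).2 h', rfl⟩, rfl⟩)

theorem isLukasiewicz_inseparableTheory : inseparableTheory.IsLukasiewicz := by
  rintro _ (⟨n, -, rfl⟩ | ⟨n, -, rfl⟩ | ⟨ψ, ⟨-, h⟩, rfl⟩)
  · trivial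
  · exact ⟨trivial, rfl⟩
  · exact ⟨⟨h, h, rfl⟩, h, rfl⟩

theorem classical_inseparableTheory : inseparableTheory.Classical := fun φ h h' =>
  .hyp (.inr (.inr ⟨φ, ⟨h, h'⟩, rfl⟩)) ⟨⟨h, h, trivial⟩, h, trivial⟩

/-! ### Consistency through a two-valued model. -/

open Classical in
/-- The classical structure on the natural numbers in which the constant `cₙ` denotes `n` and the
relation holds of the first of the two recursively inseparable sets. -/
noncomputable def crispInterp : Interp ℕ where
  fn _ n _ := n
  -- All arities need an interpretation; positivity of `k` is what makes a first argument available.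
  rel k _ a := if ∃ h : 0 < k, SelfOutput 0 (a ⟨0, h⟩) then 0 else 1

/-- The values 0 and 1 are closed under truncated subtraction and under suprema. -/
theorem eval_crispInterp {φ : Formula} (hφ : φ.IsLukasiewicz) (v : ℕ → ℕ) :
    φ.eval crispInterp v = 0 ∨ φ.eval crispInterp v = 1 := by
  induction φ generalizing v with
  | const r =>
    have hr : r.1 = 1 := hφ
    simp [Formula.eval, hr]
  | rel k i ts =>
    simp only [Formula.eval, crispInterp]
    split_ifs <;> simp
  | imp φ ψ ih₁ ih₂ =>
    simp only [Formula.eval]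
    rcases ih₁ hφ.1 v with h | h <;> rcases ih₂ hφ.2 v with h' | h' <;> simp [h, h']
  | all x φ ih =>
    by_cases h : ∃ a, φ.eval crispInterp (Function.update v x a) = 1
    · obtain ⟨a, ha⟩ := h
      exact .inr (le_antisymm (Formula.eval_mem_Icc crispInterp (.all x φ) v).2
        (ha ▸ le_ciSup (φ.bddAbove_range_eval crispInterp v x) a))
    · push Not at h
      left
      simp only [Formula.eval]
      simp [fun a => (ih hφ (Function.update v x a)).resolve_right (h a)]

theorem consistent_inseparableTheory : inseparableTheory.Consistent := by
  intro h
  have := Provable.eval_eq_zero crispInterp (fun φ hφ v => ?_) h id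
  · simp [Formula.bot, Formula.eval] at this
  · rcases hφ with ⟨n, h, rfl⟩ | ⟨n, h, rfl⟩ | ⟨ψ, ⟨-, h⟩, rfl⟩
    · simp [atom, Formula.eval, Term.eval, crispInterp, h]
    -- Disjointness of the two sets makes the denied atoms false in the model.
    · have : ¬ SelfOutput 0 n := not_selfOutput one_ne_zero h
      simp [atom, Formula.eval, Formula.neg, Formula.bot, Term.eval, crispInterp, this]
    · simp only [excludedMiddle, Formula.or, Formula.neg, Formula.bot, Formula.eval]
      rcases eval_crispInterp h v with h | h <;> simp [h]

/-! ### No decidable model and no linear-complete extension. -/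

/-- Transfers degrees between the evaluations of the diagram, which use the points `e n`, and the
evaluation satisfying the axioms. -/
theorem atom_eval {M : Type u} (S : Interp M) (n : ℕ) (v w : ℕ → M) :
    (atom n).eval S v = (atom n).eval S w :=
  Formula.eval_congr S fun x hx => (atom_isSentence n x hx).elim

theorem not_hasDecidableModel_inseparableTheory :
    ¬ Theory.HasDecidableModel.{u} inseparableTheory := by
  rintro ⟨M, _, S, v, ⟨-, -, -, e, -, hD⟩, hS⟩
  have hre : ∀ p q : UnitRat, REPred fun n =>
      WayBelow p q ((atom n).eval S v) := fun p q => by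
    refine (hD.comp (f := fun n => ((atom n).code, [], p.code, q.code)) (Primrec.to_comp
      (primrec_atom_code.pair (Primrec.const _)))).of_eq fun n => ⟨?_, fun h => ?_⟩
    · rintro ⟨φ, p', q', -, h1, h2, h3, h⟩
      obtain rfl := Formula.code_injective h1
      obtain rfl := UnitRat.code_injective h2
      obtain rfl := UnitRat.code_injective h3
      rwa [atom_eval S n v]
    · refine ⟨atom n, p, q, atom_inLang n, rfl, rfl, rfl, ?_⟩
      rwa [atom_eval S n _ v]
  refine selfOutput_inseparable
    -- The relative interiors of `[0, 2/3]` and `[1/3, 1]` cover `[0, 1]`; the first misses 1 and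
    -- the second misses 0.
    (hre ⟨0, le_rfl, zero_le_one⟩ ⟨2 / 3, by norm_num, by norm_num⟩)
    (hre ⟨1 / 3, by norm_num, by norm_num⟩ ⟨1, zero_le_one, le_rfl⟩) (fun n => ?_)
    (fun n h => ?_) (fun n h => ?_)
  · rcases lt_or_ge ((atom n).eval S v) (2 / 3) with h | h
    · exact .inl ⟨.inr rfl, .inl (by push_cast; exact h)⟩
    · exact .inr ⟨.inl (by push_cast; linarith), .inr rfl⟩
  · have h0 := hS _ (.inl ⟨n, h, rfl⟩)
    rintro ⟨h1 | h1, -⟩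
    · rw [h0] at h1
      norm_num at h1
    · norm_num at h1
  · have h0 := hS _ (.inr (.inl ⟨n, h, rfl⟩))
    have h1 : 1 - (atom n).eval S v ≤ 0 := by
      rw [← h0]
      simp [Formula.neg, Formula.eval, Formula.bot]
    rintro ⟨-, h2 | h2⟩
    · push_cast at h2
      linarith
    · norm_num at h2

theorem not_exists_linearComplete_extension_inseparableTheory :
    ¬ ∃ T : Theory, T.Extends inseparableTheory ∧ T.ComputablyAxiomatizable ∧ T.Consistent ∧
      T.LinearComplete := by
  rintro ⟨T, ⟨hf, hr, hT⟩, hax, hcon, hlin⟩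
  have hproves : ∀ n, SelfOutput 0 n → T.Proves (atom n) := fun n h => hT _ (.inl ⟨n, h, rfl⟩)
  have hrefutes : ∀ n, SelfOutput 1 n → T.Proves (atom n).neg := fun n h =>
    hT _ (.inr (.inl ⟨n, h, rfl⟩))
  have hL : ∀ n, (atom n).InLang T.lang := fun n =>
    ⟨hr rfl, fun _ => ⟨hf rfl, fun j => j.elim0⟩⟩
  have hsent : ∀ n, (atom n).neg.IsSentence := fun n x h =>
    h.elim (atom_isSentence n x) id
  have hre : ∀ F : Formula → Formula, Primrec (fun n => (F (atom n)).code) →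
      REPred fun n => T.Proves (F (atom n)) := fun F hF => by
    refine (hax.rePred_proves.comp hF.to_comp).of_eq fun n => ⟨?_, fun h => ⟨_, h, rfl⟩⟩
    rintro ⟨φ, h, hφ⟩
    exact Formula.code_injective hφ ▸ h
  have ha := primrec_atom_code
  refine selfOutput_inseparable
    -- Linear completeness is applied to an atom and its negation, so at least one of the two
    -- implications is always provable.
    (hre (fun φ => .imp φ.neg φ) (by simp only [Formula.neg, Formula.code]; fun_prop))
    (hre (fun φ => .imp φ φ.neg) (by simp only [Formula.neg, Formula.code]; fun_prop))
    (fun n => hlin _ _ ⟨hL n, trivial⟩ (hL n) (hsent n) (atom_isSentence n)) (fun n h hV => ?_)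
    (fun n h hU => ?_)
  -- A negation is an implication to ⊥, so the atom and its negation yield ⊥ by modus ponens.
  · exact hcon (.mp (hproves n h) (.mp (hproves n h) hV))
  · exact hcon (.mp (.mp (hrefutes n h) hU) (hrefutes n h))

end RPL

theorem corollary3p11 :
    ∃ T : RPL.Theory,
      (T.ComputablyAxiomatizable ∧ T.Consistent ∧ T.IsLukasiewicz ∧ T.Classical ∧
        ¬ RPL.Theory.HasDecidableModel.{u} T) ∧
      ¬ ∃ T' : RPL.Theory,
        T'.Extends T ∧ T'.ComputablyAxiomatizable ∧ T'.Consistent ∧ T'.LinearComplete :=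
  ⟨RPL.inseparableTheory, ⟨RPL.computablyAxiomatizable_inseparableTheory,
    RPL.consistent_inseparableTheory, RPL.isLukasiewicz_inseparableTheory,
    RPL.classical_inseparableTheory, RPL.not_hasDecidableModel_inseparableTheory⟩,
    RPL.not_exists_linearComplete_extension_inseparableTheory⟩
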